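/- **Theorem.** Let $\mathcal{N}=(n_j)_{j\ge 1}$ be a non-decreasing sequence of positive real numbers, and let $N(x)=\#\{j : n_j\le x\}$ be its counting function. Suppose that $N(x)=Ax+O(x^{\theta})$ as $x\to\infty$, where $A>0$ and $0\le\theta<1/2$. Then the Dirichlet series $\zeta_{\mathcal N}(s)=\sum_{j\ge1} n_j^{-s}$ converges for $\operatorname{Re}s>1$, and it has an analytic continuation to $\{\operatorname{Re}s>\theta\}\setminus\{1\}$, again denoted $\zeta_{\mathcal N}$, such that $\zeta_{\mathcal N}(s)-A/(s-1)$ is analytic on $\operatorname{Re}s>\theta$. Moreover, the following two statements are equivalent: 1. $\mathrm{LH}(\mathcal{N},Ax)$, that is: for every $\varepsilon>0$ and every $B>0$, $$\sum_{n_j\le x} n_j^{-\mathrm{i}t}=\int_{n_1}^{x}u^{-\mathrm{i}t}A\,\mathrm{d}u+O_{\varepsilon,B}\bigl((Ax)^{1/2}|t|^{\varepsilon}\bigr)$$ uniformly for all real $x$ and $t$ with $n_1\le x\le |t|^{B}$. 2. For every $\varepsilon>0$, $\zeta_{\mathcal N}(1/2+\mathrm{i}\tau)\ll_{\varepsilon}|\tau|^{\varepsilon}$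 as $|\tau|\to\infty$ ($\tau$ real). (The implied constants may depend on the sequence $\mathcal N$.) -/

import Mathlib

open Filter Asymptotics

/-- The counting function `N(x) = #{j : n_j ≤ x}` of a real sequence, repeated values being counted
with multiplicity. (The first term of the sequence is `n 0`.) -/
noncomputable def countingFunction (n : ℕ → ℝ) (x : ℝ) : ℝ :=
  ({j : ℕ | n j ≤ x}.ncard : ℝ)

/-- The exponential sum `∑_{n_j ≤ x} n_j ^ (-it)`. -/
noncomputable def expSum (n : ℕ → ℝ) (x t : ℝ) : ℂ :=
  ∑ᶠ (j : ℕ) (_ : n j ≤ x), (n j : ℂ) ^ (-(Complex.I * (t : ℂ)))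

/-- The Lindelöf hypothesis `LH(𝒩, M)` for the sequence `𝒩 = (n_j)` with associated function `M`:
for all `ε, B > 0`,
`∑_{n_j ≤ x} n_j ^ (-it) = ∫_{n_1}^x u ^ (-it) M'(u) du + O_{ε,B}(M(x) ^ (1/2) |t| ^ ε)`
for all real `x`, `t` with `n_1 ≤ x ≤ |t| ^ B`. -/
def LindelofHypothesis (n : ℕ → ℝ) (M : ℝ → ℝ) : Prop :=
  ∀ ε B : ℝ, 0 < ε → 0 < B → ∃ C : ℝ, ∀ x t : ℝ, n 0 ≤ x → x ≤ |t| ^ B →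
    ‖expSum n x t - ∫ u in (n 0)..x, (u : ℂ) ^ (-(Complex.I * (t : ℂ))) * ((deriv M u : ℝ) : ℂ)‖
      ≤ C * (M x ^ (1 / 2 : ℝ) * |t| ^ ε)

/-- `Z` is the analytic continuation to `{Re s > θ} \ {1}` of the Dirichlet series
`ζ(s) = ∑_j n_j ^ (-s)`, which converges for `Re s > 1`. Moreover `Z(s) - A / (s - 1)` extends
analytically across `s = 1`. For `θ < 1` the values of `Z` on `{Re s > θ} \ {1}` are uniquely
determined. -/
structure IsZetaContinuation (n : ℕ → ℝ) (A θ : ℝ) (Z : ℂ → ℂ) : Prop where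
  hasSum : ∀ s : ℂ, 1 < s.re → HasSum (fun j : ℕ => (n j : ℂ) ^ (-s)) (Z s)
  continuation : ∃ G : ℂ → ℂ, DifferentiableOn ℂ G {s : ℂ | θ < s.re} ∧
    ∀ s : ℂ, θ < s.re → s ≠ 1 → Z s - (A : ℂ) / (s - 1) = G s

/-! Write R_t(x) for the error `expSumError`, the twisted sum minus A ∫ u^(-it) du over [n 0, x].
Everything rests on one formula (`IsZetaContinuation.apply_eq`): with s = w + it, Z(s) = A (n
0)^(1-s)/(s-1) + w ∫ R_t(u) u^(-w-1) du for Re w > θ, s ≠ 1, the integral running over u > n 0. It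
follows from summing n_j^(-w) = w ∫ u^(-w-1) du over u > n_j for Re w > 1. Partial summation gives
R_t(u) ≪ (1+|t|) u^α for every α > θ, and the identity theorem then carries the formula to the left.
The case t = 0 constructs the continuation.

From LH to the critical line: put w = 1/2. LH controls the integral up to a power of |t|; beyond it
the partial summation bound wins because θ < 1/2.

From the critical line to LH: R_t varies by only O(√x) on a window of length about √x, since N(x) is
known up to O(√x). Hence R_t(x)/√x is, up to O(1), a smooth average over that window. Fourier
inversion expresses the average through Z on the critical line, divided by w; the smoothing makes
the integral over w converge at the cost of a power x^ε, and x^ε ≤ |t|^(Bε). -/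

/-! ### Finiteness and bounds for the counting function. -/

theorem finite_setOf_le_of_counting {n : ℕ → ℝ} (hmono : Monotone n) {A θ : ℝ} (hA : 0 < A)
    (hθ : θ < 1)
    (hN : (fun x : ℝ => countingFunction n x - A * x) =O[atTop] fun x : ℝ => x ^ θ) (x : ℝ) :
    {j | n j ≤ x}.Finite := by
  by_contra hinf
  have hall : ∀ j, n j ≤ x := fun j => by
    obtain ⟨k, hk, hjk⟩ := Set.Infinite.exists_gt hinf j
    exact (hmono hjk.le).trans hk
  -- `Set.ncard` of an infinite set is 0, so a bounded sequence would make the counting function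
  -- eventually 0, and A y would be O(y^θ) with θ < 1.
  have h1 : (fun y : ℝ => countingFunction n y - A * y) =ᶠ[atTop] fun y => (-A) * y := by
    filter_upwards [eventually_ge_atTop x] with y hy
    have : {j | n j ≤ y} = Set.univ := Set.eq_univ_of_forall fun j => (hall j).trans hy
    simp [countingFunction, this]
  have h2 : (fun y : ℝ => (-A) * y) =O[atTop] fun y : ℝ => y ^ θ := h1.symm.trans_isBigO hN
  have h3 : (fun y : ℝ => y) =O[atTop] fun y : ℝ => y ^ θ :=
    (isBigO_const_mul_left_iff (neg_ne_zero.mpr hA.ne')).1 h2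
  have h4 : (fun y : ℝ => y ^ θ) =o[atTop] fun y : ℝ => y := by
    refine isLittleO_of_tendsto' ((eventually_ne_atTop 0).mono fun y hy h => absurd h hy) ?_
    refine (tendsto_rpow_neg_atTop (sub_pos.2 hθ)).congr' ?_
    filter_upwards [eventually_gt_atTop 0] with y hy
    rw [neg_sub, Real.rpow_sub_one hy.ne']
  have h5 := h3.trans_isLittleO h4
  have h6 := (isLittleO_irrefl' (f' := fun y : ℝ => y) (l := atTop)
    ((eventually_ne_atTop 0).frequently.mono fun y hy => by simpa using hy))
  exact h6 h5

theorem countingFunction_mono {n : ℕ → ℝ} (hfin : ∀ x, {j | n j ≤ x}.Finite) :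
    Monotone (fun x => ({j : ℕ | n j ≤ x}.ncard)) := fun _ y hxy =>
  Set.ncard_le_ncard (fun _ hj => le_trans hj hxy) (hfin y)

/-- On the bounded range from n 0 to the threshold X the left side is bounded and x^θ ≥ (n 0)^θ > 0,
so a larger constant covers every x ≥ n 0. -/
theorem counting_eventual_bound {n : ℕ → ℝ} (hpos : 0 < n 0)
    (hfin : ∀ x, {j | n j ≤ x}.Finite) {A θ : ℝ} (hA : 0 < A) (hθ : 0 ≤ θ)
    (hN : (fun x : ℝ => countingFunction n x - A * x) =O[atTop] fun x : ℝ => x ^ θ) :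
    ∃ C, 0 < C ∧ ∀ x, n 0 ≤ x → |countingFunction n x - A * x| ≤ C * x ^ θ := by
  obtain ⟨c, hc, hb⟩ := hN.exists_pos
  obtain ⟨X, hX⟩ := eventually_atTop.1 hb.bound
  set K := countingFunction n X + A * |X| with hK
  have hK0 : 0 ≤ K := by simp only [hK, countingFunction]; positivity
  refine ⟨c + K / (n 0) ^ θ, by positivity, fun x hx => ?_⟩
  have hx0 : 0 < x := hpos.trans_le hx
  have hxθ : (n 0) ^ θ ≤ x ^ θ := Real.rpow_le_rpow hpos.le hx hθ
  have h0 : 0 < (n 0) ^ θ := Real.rpow_pos_of_pos hpos θ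
  rcases le_or_gt X x with h | h
  · have := hX x h
    rw [Real.norm_eq_abs, Real.norm_eq_abs, abs_of_pos (Real.rpow_pos_of_pos hx0 θ)] at this
    refine this.trans ?_
    gcongr
    simp; positivity
  · have h1 : countingFunction n x ≤ countingFunction n X := by
      unfold countingFunction; exact_mod_cast countingFunction_mono hfin h.le
    have h2 : 0 ≤ countingFunction n x := by unfold countingFunction; positivity
    have h3 : A * x ≤ A * |X| := by gcongr; exact h.le.trans (le_abs_self X)
    have h4 : |countingFunction n x - A * x| ≤ K := by
      rw [abs_le]; constructor <;> nlinarith [mul_pos hA hx0]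
    calc _ ≤ K := h4
      _ = K / (n 0) ^ θ * (n 0) ^ θ := by field_simp
      _ ≤ K / (n 0) ^ θ * x ^ θ := by gcongr
      _ ≤ _ := by
        have := Real.rpow_pos_of_pos hx0 θ
        nlinarith [mul_pos hc this]

/-! ### The exponential sum and its error term: finite form, measurability, trivial bounds. -/

theorem expSum_eq_sum {n : ℕ → ℝ} (hfin : ∀ x, {j | n j ≤ x}.Finite) (x t : ℝ) :
    expSum n x t = ∑ j ∈ (hfin x).toFinset, (n j : ℂ) ^ (-(Complex.I * (t : ℂ))) := by
  unfold expSum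
  exact finsum_mem_eq_finite_toFinset_sum (s := {j | n j ≤ x}) _ (hfin x)

/-- By monotonicity the indices form an initial segment, so `expSum` factors through the monotone,
ℕ-valued count; this is what makes it measurable in x. -/
theorem toFinset_setOf_le_eq_range {n : ℕ → ℝ} (hmono : Monotone n)
    (hfin : ∀ x, {j | n j ≤ x}.Finite) (x : ℝ) :
    (hfin x).toFinset = Finset.range ({j | n j ≤ x}.ncard) := by
  have hex : ∃ m, ¬ n m ≤ x := by
    by_contra! h
    exact Set.infinite_univ ((hfin x).subset fun j _ => h j)
  classical
  have h : (hfin x).toFinset = Finset.range (Nat.find hex) := by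
    ext j
    simp only [Set.Finite.mem_toFinset, Set.mem_ofPred_eq, Finset.mem_range, Nat.lt_find_iff,
      not_not]
    exact ⟨fun hj m hm => (hmono hm).trans hj, fun h => h j le_rfl⟩
  rw [Set.ncard_eq_toFinset_card _ (hfin x), h, Finset.card_range]

theorem measurable_expSum {n : ℕ → ℝ} (hmono : Monotone n) (hfin : ∀ x, {j | n j ≤ x}.Finite)
    (t : ℝ) : Measurable (fun x => expSum n x t) := by
  have : (fun x => expSum n x t) = (fun k : ℕ => ∑ j ∈ Finset.range k,
      (n j : ℂ) ^ (-(Complex.I * (t : ℂ)))) ∘ fun x => ({j | n j ≤ x}.ncard) := by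
    funext x
    rw [expSum_eq_sum hfin, toFinset_setOf_le_eq_range hmono hfin]; rfl
  rw [this]
  exact (measurable_of_countable _).comp (countingFunction_mono hfin).measurable

theorem norm_cpow_neg_I_mul {u : ℝ} (hu : 0 < u) (t : ℝ) :
    ‖(u : ℂ) ^ (-(Complex.I * (t : ℂ)))‖ = 1 := by
  rw [Complex.norm_cpow_eq_rpow_re_of_pos hu]; simp

theorem expSum_sub_norm_le {n : ℕ → ℝ} (hpos : ∀ j, 0 < n j)
    (hfin : ∀ x, {j | n j ≤ x}.Finite) {x y : ℝ} (hxy : x ≤ y) (t : ℝ) :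
    ‖expSum n y t - expSum n x t‖ ≤ countingFunction n y - countingFunction n x := by
  have hsub : (hfin x).toFinset ⊆ (hfin y).toFinset := fun j hj => by
    simp only [Set.Finite.mem_toFinset, Set.mem_ofPred_eq] at *; exact hj.trans hxy
  rw [expSum_eq_sum hfin, expSum_eq_sum hfin, ← Finset.sum_sdiff hsub, add_sub_cancel_right]
  refine (norm_sum_le _ _).trans ?_
  simp_rw [norm_cpow_neg_I_mul (hpos _)]
  rw [countingFunction, countingFunction, Set.ncard_eq_toFinset_card _ (hfin y),
    Set.ncard_eq_toFinset_card _ (hfin x), ← Finset.card_sdiff_add_card_eq_card hsub]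
  simp

theorem expSum_norm_le {n : ℕ → ℝ} (hpos : ∀ j, 0 < n j)
    (hfin : ∀ x, {j | n j ≤ x}.Finite) (x t : ℝ) :
    ‖expSum n x t‖ ≤ countingFunction n x := by
  rw [expSum_eq_sum hfin]
  refine (norm_sum_le _ _).trans ?_
  simp_rw [norm_cpow_neg_I_mul (hpos _)]
  rw [countingFunction, Set.ncard_eq_toFinset_card _ (hfin x)]
  simp

/-- The error term `∑_{n_j ≤ x} n_j ^ (-it) - A ∫_{n_0}^x u ^ (-it) du`. -/
noncomputable def expSumError (n : ℕ → ℝ) (A t x : ℝ) : ℂ :=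
  expSum n x t - A * ∫ u in (n 0)..x, (u : ℂ) ^ (-(Complex.I * (t : ℂ)))

theorem continuousOn_ofReal_cpow (s : ℂ) :
    ContinuousOn (fun u : ℝ => (u : ℂ) ^ s) (Set.Ioi 0) := fun u hu =>
  (Complex.continuousAt_ofReal_cpow_const u s (Or.inr (ne_of_gt hu))).continuousWithinAt

theorem intervalIntegrable_ofReal_cpow {a b : ℝ} (ha : 0 < a) (hb : 0 < b) (s : ℂ) :
    IntervalIntegrable (fun u : ℝ => (u : ℂ) ^ s) MeasureTheory.volume a b :=
  ((continuousOn_ofReal_cpow s).mono fun _ hu => (lt_min ha hb).trans_le hu.1).intervalIntegrable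

theorem norm_integral_cpow_le {a b : ℝ} (ha : 0 < a) (hab : a ≤ b) (t : ℝ) :
    ‖∫ u in a..b, (u : ℂ) ^ (-(Complex.I * (t : ℂ)))‖ ≤ b - a := by
  have := intervalIntegral.norm_integral_le_of_norm_le_const (a := a) (b := b) (C := 1)
    (f := fun u : ℝ => (u : ℂ) ^ (-(Complex.I * (t : ℂ)))) (fun u hu => by
      rw [Set.uIoc_of_le hab] at hu
      exact (norm_cpow_neg_I_mul (ha.trans hu.1) t).le)
  rwa [one_mul, abs_of_nonneg (by linarith)] at this

theorem expSumError_sub_norm_le {n : ℕ → ℝ} (hpos : ∀ j, 0 < n j)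
    (hfin : ∀ x, {j | n j ≤ x}.Finite) {A : ℝ} (hA : 0 < A) {x y : ℝ} (hx : n 0 ≤ x)
    (hxy : x ≤ y) (t : ℝ) :
    ‖expSumError n A t y - expSumError n A t x‖
      ≤ countingFunction n y - countingFunction n x + A * (y - x) := by
  have hx0 := (hpos 0).trans_le hx
  have h : expSumError n A t y - expSumError n A t x = (expSum n y t - expSum n x t)
      - A * ∫ u in x..y, (u : ℂ) ^ (-(Complex.I * (t : ℂ))) := by
    unfold expSumError
    rw [← intervalIntegral.integral_add_adjacent_intervals
      (intervalIntegrable_ofReal_cpow (hpos 0) hx0 _)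
      (intervalIntegrable_ofReal_cpow hx0 (hx0.trans_le hxy) _)]
    ring
  rw [h]
  refine (norm_sub_le _ _).trans (add_le_add (expSum_sub_norm_le hpos hfin hxy t) ?_)
  rw [norm_mul, Complex.norm_real, Real.norm_of_nonneg hA.le]
  gcongr
  exact norm_integral_cpow_le hx0 hxy t

theorem expSumError_norm_le {n : ℕ → ℝ} (hpos : ∀ j, 0 < n j)
    (hfin : ∀ x, {j | n j ≤ x}.Finite) {A : ℝ} (hA : 0 < A) {x : ℝ} (hx : n 0 ≤ x) (t : ℝ) :
    ‖expSumError n A t x‖ ≤ countingFunction n x + A * x := by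
  unfold expSumError
  refine (norm_sub_le _ _).trans (add_le_add (expSum_norm_le hpos hfin x t) ?_)
  rw [norm_mul, Complex.norm_real, Real.norm_of_nonneg hA.le]
  gcongr
  refine (norm_integral_cpow_le (hpos 0) hx t).trans ?_
  linarith [hpos 0]

theorem lindelofHypothesis_iff (n : ℕ → ℝ) (A : ℝ) :
    LindelofHypothesis n (fun x => A * x) ↔
      ∀ ε B : ℝ, 0 < ε → 0 < B → ∃ C : ℝ, ∀ x t : ℝ, n 0 ≤ x → x ≤ |t| ^ B →
        ‖expSumError n A t x‖ ≤ C * ((A * x) ^ (1 / 2 : ℝ) * |t| ^ ε) := by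
  have h : ∀ u, deriv (fun x => A * x) u = A := fun u => by simp
  unfold LindelofHypothesis expSumError
  simp only [h, intervalIntegral.integral_mul_const, mul_comm (A : ℂ)]

theorem rpow_le_rpow_mul_rpow_of_le {a x α β : ℝ} (ha : 0 < a) (hx : a ≤ x) (h : α ≤ β) :
    x ^ α ≤ a ^ (α - β) * x ^ β := by
  have hx0 := ha.trans_le hx
  have h1 : x ^ (α - β) ≤ a ^ (α - β) :=
    Real.rpow_le_rpow_of_nonpos ha hx (by linarith)
  calc x ^ α = x ^ (α - β) * x ^ β := by rw [← Real.rpow_add hx0]; ring_nf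
    _ ≤ _ := by gcongr

theorem counting_linear_bound {n : ℕ → ℝ} (hpos : 0 < n 0) {A θ C : ℝ} (hA : 0 < A)
    (hC : 0 < C) (hθ : θ < 1)
    (hE : ∀ x, n 0 ≤ x → |countingFunction n x - A * x| ≤ C * x ^ θ) :
    ∃ K, 0 < K ∧ ∀ x, n 0 ≤ x → countingFunction n x ≤ K * x := by
  have h0 : 0 < n 0 ^ (θ - 1) := Real.rpow_pos_of_pos hpos _
  refine ⟨A + C * n 0 ^ (θ - 1), by positivity, fun x hx => ?_⟩
  have h1 := (abs_le.1 (hE x hx)).2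
  have h2 := rpow_le_rpow_mul_rpow_of_le hpos hx hθ.le
  rw [Real.rpow_one] at h2
  nlinarith [mul_le_mul_of_nonneg_left h2 hC.le]

theorem summable_rpow_neg {n : ℕ → ℝ} (hpos : ∀ j, 0 < n j) (hmono : Monotone n)
    (hfin : ∀ x, {j | n j ≤ x}.Finite) {K : ℝ} (hK0 : 0 < K)
    (hK : ∀ x, n 0 ≤ x → countingFunction n x ≤ K * x) {σ : ℝ} (hσ : 1 < σ) :
    Summable fun j => n j ^ (-σ) := by
  -- The j + 1 indices 0, ..., j are all counted at n j, so n j grows at least linearly in j.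
  have h1 : ∀ j : ℕ, ((j + 1 : ℕ) : ℝ) ≤ K * n j := fun j => by
    refine le_trans ?_ (hK (n j) (hmono (Nat.zero_le j)))
    unfold countingFunction
    have : (Set.Iic j).ncard ≤ {i | n i ≤ n j}.ncard :=
      Set.ncard_le_ncard (fun i hi => hmono hi) (hfin _)
    rw [← Finset.coe_Iic, Set.ncard_coe_finset, Nat.card_Iic] at this
    exact_mod_cast this
  have h2 : Summable fun j : ℕ => K ^ σ * ((j + 1 : ℕ) : ℝ) ^ (-σ) :=
    (((Real.summable_nat_rpow (p := -σ)).2 (by linarith)).comp_injective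
      (add_left_injective 1)).mul_left _
  refine h2.of_nonneg_of_le (fun j => (Real.rpow_pos_of_pos (hpos j) _).le) fun j => ?_
  have h3 : (K * n j) ^ (-σ) ≤ ((j + 1 : ℕ) : ℝ) ^ (-σ) :=
    Real.rpow_le_rpow_of_nonpos (by positivity) (h1 j) (by linarith)
  rw [Real.mul_rpow hK0.le (hpos j).le] at h3
  calc n j ^ (-σ) = K ^ σ * (K ^ (-σ) * n j ^ (-σ)) := by
        rw [← mul_assoc, ← Real.rpow_add hK0]; simp
    _ ≤ _ := by gcongr

/-! ### Mellin integrals and the Dirichlet series as one of them. -/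

theorem integrableOn_mul_cpow {f : ℝ → ℂ} (hf : Measurable f) {a α M : ℝ} (ha : 0 < a)
    (hM : ∀ u, a ≤ u → ‖f u‖ ≤ M * u ^ α) {w : ℂ} (hw : α < w.re) :
    MeasureTheory.IntegrableOn (fun u : ℝ => f u * (u : ℂ) ^ (-w - 1)) (Set.Ioi a) := by
  have hcp : MeasureTheory.AEStronglyMeasurable (fun u : ℝ => (u : ℂ) ^ (-w - 1))
      (MeasureTheory.volume.restrict (Set.Ioi a)) :=
    ((continuousOn_ofReal_cpow _).mono (Set.Ioi_subset_Ioi ha.le)).aestronglyMeasurable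
      measurableSet_Ioi
  refine MeasureTheory.Integrable.mono' (g := fun u => M * u ^ (α - w.re - 1))
    ((integrableOn_Ioi_rpow_of_lt (by linarith) ha).const_mul M)
    (hf.aestronglyMeasurable.mul hcp) ?_
  filter_upwards [MeasureTheory.ae_restrict_mem measurableSet_Ioi] with u hu
  have hu0 : 0 < u := ha.trans hu
  rw [norm_mul, Complex.norm_cpow_eq_rpow_re_of_pos hu0]
  calc _ ≤ M * u ^ α * u ^ ((-w - 1).re) := by gcongr; exact hM u (le_of_lt hu)
    _ = _ := by
      rw [mul_assoc, ← Real.rpow_add hu0]; congr 2; simp; ring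

theorem differentiableAt_integral_mul_cpow {f : ℝ → ℂ} (hf : Measurable f) {a α M : ℝ}
    (ha : 0 < a) (hM : ∀ u, a ≤ u → ‖f u‖ ≤ M * u ^ α) {w : ℂ} (hw : α < w.re) :
    DifferentiableAt ℂ (fun w : ℂ => ∫ u in Set.Ioi a, f u * (u : ℂ) ^ (-w - 1)) w := by
  have heq : (fun w : ℂ => ∫ u in Set.Ioi a, f u * (u : ℂ) ^ (-w - 1))
      = (mellin ((Set.Ioi a).indicator f)) ∘ fun w => -w := by
    funext w
    simp only [mellin, Function.comp_apply]
    have : ∀ t : ℝ, (t : ℂ) ^ (-w - 1) • (Set.Ioi a).indicator f t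
        = (Set.Ioi a).indicator (fun u => f u * (u : ℂ) ^ (-w - 1)) t := fun t => by
      by_cases h : t ∈ Set.Ioi a <;> simp [h, mul_comm]
    simp_rw [this]
    rw [MeasureTheory.setIntegral_indicator measurableSet_Ioi,
      Set.inter_eq_right.2 (Set.Ioi_subset_Ioi ha.le)]
  rw [heq]
  refine DifferentiableAt.comp w ?_ differentiableAt_id.neg
  -- The function vanishes near 0, so any exponent there works; -Re w - 1 merely lies below -Re w.
  refine mellin_differentiableAt_of_isBigO_rpow (a := -α) (b := -w.re - 1) ?_ ?_ ?_ ?_ ?_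
  · have h1 := (MeasureTheory.integrable_indicator_iff measurableSet_Ioi).2
      (integrableOn_mul_cpow hf ha hM hw)
    have h2 := (h1.integrableOn (s := Set.Ioi 0)).locallyIntegrableOn
    have h3 := h2.mul_continuousOn (continuousOn_ofReal_cpow (w + 1)) isOpen_Ioi.isLocallyClosed
    refine h3.congr ?_
    filter_upwards [MeasureTheory.ae_restrict_mem measurableSet_Ioi] with u hu
    by_cases h : u ∈ Set.Ioi a
    · rw [Set.indicator_of_mem h, Set.indicator_of_mem h, mul_assoc, ← Complex.cpow_add _ _
        (by exact_mod_cast ne_of_gt hu)]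
      simp
    · simp [Set.indicator_of_notMem h]
  · refine IsBigO.of_bound M ?_
    filter_upwards [eventually_gt_atTop a] with u hu
    rw [Set.indicator_of_mem (Set.mem_Ioi.2 hu), neg_neg,
      Real.norm_of_nonneg (Real.rpow_nonneg (ha.trans hu).le _)]
    exact hM u hu.le
  · simpa using hw
  · have : (Set.Ioi a).indicator f =ᶠ[nhdsWithin 0 (Set.Ioi 0)] fun _ => 0 := by
      filter_upwards [mem_nhdsWithin_of_mem_nhds (Iio_mem_nhds ha)] with u hu
      exact Set.indicator_of_notMem (by simpa using le_of_lt hu) _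
    exact this.trans_isBigO (isBigO_zero _ _)
  · simp

/-- Each n_j^(-w) is w ∫ u^(-w-1) du over u > n_j; the twist n_j^(-it) stays as a coefficient, and
sum and integral are exchanged by absolute convergence for Re w > 1. -/
theorem hasSum_mul_cpow_eq_integral_expSum {n : ℕ → ℝ} (hpos : ∀ j, 0 < n j) (hmono : Monotone n)
    (hfin : ∀ x, {j | n j ≤ x}.Finite) {K : ℝ} (hK0 : 0 < K)
    (hK : ∀ x, n 0 ≤ x → countingFunction n x ≤ K * x) (t : ℝ) {w : ℂ} (hw : 1 < w.re) :
    HasSum (fun j => (n j : ℂ) ^ (-(w + Complex.I * t)))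
      (w * ∫ u in Set.Ioi (n 0), expSum n u t * (u : ℂ) ^ (-w - 1)) := by
  have hw0 : w ≠ 0 := fun h => by simp [h] at hw; linarith
  have hwre : (-w - 1).re < -1 := by simp; linarith
  set F : ℕ → ℝ → ℂ := fun j => (Set.Ici (n j)).indicator
    fun u => (n j : ℂ) ^ (-(Complex.I * (t : ℂ))) * (u : ℂ) ^ (-w - 1) with hF
  have hint : ∀ j, MeasureTheory.Integrable (F j) := fun j => by
    rw [hF, MeasureTheory.integrable_indicator_iff measurableSet_Ici, integrableOn_Ici_iff_integrableOn_Ioi]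
    exact (integrableOn_Ioi_cpow_of_lt hwre (hpos j)).const_mul _
  have hval : ∀ j, ∫ u, F j u = (n j : ℂ) ^ (-(w + Complex.I * t)) / w := fun j => by
    simp only [hF]
    have hn : (n j : ℂ) ≠ 0 := by exact_mod_cast (hpos j).ne'
    rw [MeasureTheory.integral_indicator measurableSet_Ici,
      MeasureTheory.integral_Ici_eq_integral_Ioi, MeasureTheory.integral_const_mul,
      integral_Ioi_cpow_of_lt hwre (hpos j), sub_add_cancel, neg_add,
      Complex.cpow_add (-w) (-(Complex.I * t)) hn]
    field_simp
  have hnorm : ∀ j, ∫ u, ‖F j u‖ = n j ^ (-w.re) / w.re := fun j => by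
    have : ∀ u, ‖F j u‖ = (Set.Ici (n j)).indicator (fun u => u ^ (-w.re - 1)) u := fun u => by
      simp only [hF]
      by_cases h : u ∈ Set.Ici (n j)
      · rw [Set.indicator_of_mem h, Set.indicator_of_mem h, norm_mul,
          norm_cpow_neg_I_mul (hpos j), one_mul,
          Complex.norm_cpow_eq_rpow_re_of_pos ((hpos j).trans_le h)]
        simp
      · simp [Set.indicator_of_notMem h]
    simp_rw [this]
    rw [MeasureTheory.integral_indicator measurableSet_Ici,
      MeasureTheory.integral_Ici_eq_integral_Ioi, integral_Ioi_rpow_of_lt (by linarith) (hpos j),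
      sub_add_cancel, neg_div_neg_eq]
  have hsum : Summable fun j => ∫ u, ‖F j u‖ := by
    simp_rw [hnorm]
    exact (summable_rpow_neg hpos hmono hfin hK0 hK hw).div_const _
  have h := (MeasureTheory.hasSum_integral_of_summable_integral_norm hint hsum).mul_left w
  have htsum : ∀ u, ∑' j, F j u = (Set.Ici (n 0)).indicator
      (fun u => expSum n u t * (u : ℂ) ^ (-w - 1)) u := fun u => by
    have h1 : ∑' j, F j u = expSum n u t * (u : ℂ) ^ (-w - 1) := by
      rw [expSum_eq_sum hfin, Finset.sum_mul, tsum_eq_sum (s := (hfin u).toFinset)]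
      · refine Finset.sum_congr rfl fun j hj => ?_
        simp only [Set.Finite.mem_toFinset, Set.mem_ofPred_eq] at hj
        simp only [hF]
        rw [Set.indicator_of_mem (Set.mem_Ici.2 hj)]
      · intro j hj
        simp only [Set.Finite.mem_toFinset, Set.mem_ofPred_eq] at hj
        simp only [hF]
        rw [Set.indicator_of_notMem (by simpa using hj)]
    by_cases hu : u ∈ Set.Ici (n 0)
    · rw [h1, Set.indicator_of_mem hu]
    · rw [Set.indicator_of_notMem hu, h1, expSum_eq_sum hfin, Finset.sum_eq_zero, zero_mul]
      intro j hj
      simp only [Set.Finite.mem_toFinset, Set.mem_ofPred_eq] at hj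
      exact absurd ((hmono (Nat.zero_le j)).trans hj) hu
  simp_rw [htsum, hval] at h
  rw [MeasureTheory.integral_indicator measurableSet_Ici,
      MeasureTheory.integral_Ici_eq_integral_Ioi] at h
  simpa only [mul_div_cancel₀ _ hw0] using h

/-! ### Partial summation for the error term. -/

theorem I_mul_integral_cpow {c x : ℝ} (hc : 0 < c) (hcx : c ≤ x) (t : ℝ) :
    Complex.I * t * ∫ v in c..x, (v : ℂ) ^ (-(Complex.I * (t : ℂ)) - 1)
      = (c : ℂ) ^ (-(Complex.I * (t : ℂ))) - (x : ℂ) ^ (-(Complex.I * (t : ℂ))) := by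
  rcases eq_or_ne t 0 with rfl | ht
  · simp
  · have htc : (t : ℂ) ≠ 0 := by exact_mod_cast ht
    have h0 : Complex.I * (t : ℂ) ≠ 0 := by simp [ht]
    rw [integral_cpow (Or.inr ⟨fun h => h0 (by linear_combination -h), fun h => by
      rw [Set.uIcc_of_le hcx] at h; linarith [h.1]⟩), sub_add_cancel]
    field_simp
    ring

theorem one_sub_I_mul_ne_zero (t : ℝ) : 1 - Complex.I * (t : ℂ) ≠ 0 := fun h => by
  have := congrArg Complex.re h
  simp at this

theorem integral_cpow_neg_I_mul {c x : ℝ} (hc : 0 < c) (hcx : c ≤ x) (t : ℝ) :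
    (1 - Complex.I * t) * ∫ v in c..x, (v : ℂ) ^ (-(Complex.I * (t : ℂ)))
      = x * (x : ℂ) ^ (-(Complex.I * (t : ℂ))) - c * (c : ℂ) ^ (-(Complex.I * (t : ℂ))) := by
  have h0 := one_sub_I_mul_ne_zero t
  have h1 : -(Complex.I * (t : ℂ)) + 1 ≠ 0 := fun h => h0 (by linear_combination h)
  have hc0 : (c : ℂ) ≠ 0 := by exact_mod_cast hc.ne'
  have hx0 : (x : ℂ) ≠ 0 := by exact_mod_cast (hc.trans_le hcx).ne'
  rw [integral_cpow (Or.inl (by simp)), Complex.cpow_add _ _ hc0, Complex.cpow_add _ _ hx0,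
    Complex.cpow_one, Complex.cpow_one, show 1 - Complex.I * (t : ℂ) = -(Complex.I * t) + 1 by ring,
    mul_div_cancel₀ _ h1]
  ring

theorem integral_counting_mul {n : ℕ → ℝ} (hmono : Monotone n)
    (hfin : ∀ x, {j | n j ≤ x}.Finite) {x : ℝ} {f : ℝ → ℂ} (hx : n 0 ≤ x)
    (hf : ContinuousOn f (Set.Icc (n 0) x)) :
    MeasureTheory.IntegrableOn (fun v => (countingFunction n v : ℂ) * f v) (Set.Icc (n 0) x) ∧
    ∫ v in (n 0)..x, (countingFunction n v : ℂ) * f v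
      = ∑ j ∈ (hfin x).toFinset, ∫ v in (n j)..x, f v := by
  have hcongr : Set.EqOn (fun v => (countingFunction n v : ℂ) * f v)
      (fun v => ∑ j ∈ (hfin x).toFinset, (Set.Ici (n j)).indicator f v) (Set.Icc (n 0) x) := by
    intro v hv
    have hsub : (hfin v).toFinset ⊆ (hfin x).toFinset := fun j hj => by
      simp only [Set.Finite.mem_toFinset, Set.mem_ofPred_eq] at *; exact hj.trans hv.2
    simp only
    rw [← Finset.sum_subset hsub]
    · rw [Finset.sum_congr rfl (g := fun _ => f v), Finset.sum_const, countingFunction,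
        Set.ncard_eq_toFinset_card _ (hfin v)]
      · simp
      · intro j hj
        simp only [Set.Finite.mem_toFinset, Set.mem_ofPred_eq] at hj
        exact Set.indicator_of_mem (Set.mem_Ici.2 hj) _
    · intro j _ hj
      simp only [Set.Finite.mem_toFinset, Set.mem_ofPred_eq] at hj
      exact Set.indicator_of_notMem (by simpa using hj) _
  have hint : MeasureTheory.IntegrableOn f (Set.Icc (n 0) x) := hf.integrableOn_Icc
  constructor
  · refine (MeasureTheory.integrableOn_congr_fun hcongr measurableSet_Icc).2 ?_
    exact MeasureTheory.integrable_finsetSum _ fun j _ => hint.indicator measurableSet_Ici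
  rw [intervalIntegral.integral_of_le hx, ← MeasureTheory.integral_Icc_eq_integral_Ioc,
    MeasureTheory.setIntegral_congr_fun measurableSet_Icc hcongr,
    MeasureTheory.integral_finsetSum _ fun j _ => hint.indicator measurableSet_Ici]
  refine Finset.sum_congr rfl fun j hj => ?_
  simp only [Set.Finite.mem_toFinset, Set.mem_ofPred_eq] at hj
  rw [intervalIntegral.integral_of_le hj, ← MeasureTheory.integral_Icc_eq_integral_Ioc,
    MeasureTheory.setIntegral_indicator measurableSet_Ici]
  congr 2
  ext v
  simp only [Set.mem_inter_iff, Set.mem_Icc, Set.mem_Ici]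
  exact ⟨fun h => ⟨h.2, h.1.2⟩, fun h => ⟨⟨(hmono (Nat.zero_le j)).trans h.1, h.2⟩, h.1⟩⟩

/-- Partial summation for u^(-it) against dN - A du on [n 0, x]. The Lebesgue part starts at n 0,
hence the primitive N(v) - A(v - n 0) and no boundary term at n 0. -/
theorem expSumError_eq {n : ℕ → ℝ} (hpos : ∀ j, 0 < n j) (hmono : Monotone n)
    (hfin : ∀ x, {j | n j ≤ x}.Finite) (A : ℝ) {x : ℝ} (hx : n 0 ≤ x) (t : ℝ) :
    expSumError n A t x =
      ((countingFunction n x - A * (x - n 0) : ℝ) : ℂ) * (x : ℂ) ^ (-(Complex.I * (t : ℂ)))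
      + Complex.I * t * ∫ v in (n 0)..x, ((countingFunction n v - A * (v - n 0) : ℝ) : ℂ)
          * (v : ℂ) ^ (-(Complex.I * (t : ℂ)) - 1) := by
  have hx0 := (hpos 0).trans_le hx
  have hcont : ContinuousOn (fun v : ℝ => (v : ℂ) ^ (-(Complex.I * (t : ℂ)) - 1))
      (Set.Icc (n 0) x) :=
    (continuousOn_ofReal_cpow _).mono fun v hv => (hpos 0).trans_le hv.1
  obtain ⟨hi, he⟩ := integral_counting_mul hmono hfin hx hcont
  have hi1 : IntervalIntegrable (fun v => (countingFunction n v : ℂ)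
      * (v : ℂ) ^ (-(Complex.I * (t : ℂ)) - 1)) MeasureTheory.volume (n 0) x :=
    (intervalIntegrable_iff_integrableOn_Icc_of_le hx).2 hi
  have hi2 := (intervalIntegrable_ofReal_cpow (hpos 0) hx0 (-(Complex.I * (t : ℂ)))).const_mul
    (A : ℂ)
  have hi3 := (intervalIntegrable_ofReal_cpow (hpos 0) hx0 (-(Complex.I * (t : ℂ)) - 1)).const_mul
    (A * n 0 : ℂ)
  have hsplit : ∫ v in (n 0)..x, ((countingFunction n v - A * (v - n 0) : ℝ) : ℂ)
          * (v : ℂ) ^ (-(Complex.I * (t : ℂ)) - 1)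
      = (∫ v in (n 0)..x, (countingFunction n v : ℂ) * (v : ℂ) ^ (-(Complex.I * (t : ℂ)) - 1))
        - A * (∫ v in (n 0)..x, (v : ℂ) ^ (-(Complex.I * (t : ℂ))))
        + A * n 0 * ∫ v in (n 0)..x, (v : ℂ) ^ (-(Complex.I * (t : ℂ)) - 1) := by
    rw [← intervalIntegral.integral_const_mul, ← intervalIntegral.integral_const_mul,
      ← intervalIntegral.integral_sub hi1 hi2, ← intervalIntegral.integral_add (hi1.sub hi2) hi3]
    refine intervalIntegral.integral_congr fun v hv => ?_
    rw [Set.uIcc_of_le hx] at hv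
    have hv0 : (v : ℂ) ≠ 0 := by exact_mod_cast ((hpos 0).trans_le hv.1).ne'
    simp only [Complex.cpow_sub _ _ hv0, Complex.cpow_one]
    push_cast
    field_simp
    ring
  have hS : Complex.I * t * (∫ v in (n 0)..x, (countingFunction n v : ℂ)
      * (v : ℂ) ^ (-(Complex.I * (t : ℂ)) - 1))
      = expSum n x t - countingFunction n x * (x : ℂ) ^ (-(Complex.I * (t : ℂ))) := by
    rw [he, Finset.mul_sum, expSum_eq_sum hfin, countingFunction,
      Set.ncard_eq_toFinset_card _ (hfin x)]
    rw [Finset.sum_congr rfl fun j hj => I_mul_integral_cpow (hpos j)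
      (by simpa using hj) t, Finset.sum_sub_distrib]
    simp
  have h1 := I_mul_integral_cpow (hpos 0) hx t
  have h2 := integral_cpow_neg_I_mul (hpos 0) hx t
  rw [hsplit, expSumError]
  push_cast
  linear_combination -hS - A * n 0 * h1 - A * h2

theorem expSumError_zero_right {n : ℕ → ℝ} (A : ℝ)
    (hfin : ∀ x, {j | n j ≤ x}.Finite) (x : ℝ) :
    expSumError n A 0 x = ((countingFunction n x - A * (x - n 0) : ℝ) : ℂ) := by
  rw [expSumError, expSum_eq_sum hfin, countingFunction, Set.ncard_eq_toFinset_card _ (hfin x)]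
  simp

/-- Strict positivity of α keeps ∫ v^(α-1) dv of size x^α/α; at α = 0 a logarithm would appear. -/
theorem expSumError_bound {n : ℕ → ℝ} (hpos : ∀ j, 0 < n j) (hmono : Monotone n)
    (hfin : ∀ x, {j | n j ≤ x}.Finite) {A : ℝ} {x : ℝ} (hx : n 0 ≤ x) (t : ℝ) {C α : ℝ}
    (hα : 0 < α)
    (hE : ∀ x, n 0 ≤ x → |countingFunction n x - A * (x - n 0)| ≤ C * x ^ α) :
    ‖expSumError n A t x‖ ≤ C * (1 + |t| / α) * x ^ α := by
  have hx0 := (hpos 0).trans_le hx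
  have hC : 0 ≤ C := by
    have := (abs_nonneg _).trans (hE x hx)
    exact nonneg_of_mul_nonneg_left this (Real.rpow_pos_of_pos hx0 _)
  have hI : ‖∫ v in (n 0)..x, ((countingFunction n v - A * (v - n 0) : ℝ) : ℂ)
      * (v : ℂ) ^ (-(Complex.I * (t : ℂ)) - 1)‖ ≤ ∫ v in (n 0)..x, C * v ^ (α - 1) := by
    refine intervalIntegral.norm_integral_le_of_norm_le hx ?_
      ((intervalIntegral.intervalIntegrable_rpow' (by linarith)).const_mul _)
    filter_upwards with v hv
    have hv0 := (hpos 0).trans hv.1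
    rw [norm_mul, Complex.norm_cpow_eq_rpow_re_of_pos hv0, Complex.norm_real, Real.norm_eq_abs]
    calc _ ≤ C * v ^ α * v ^ (-(Complex.I * (t : ℂ)) - 1).re := by gcongr; exact hE v hv.1.le
      _ = _ := by rw [mul_assoc, ← Real.rpow_add hv0]; congr 2; simp; ring
  rw [intervalIntegral.integral_const_mul, integral_rpow (Or.inl (by linarith)),
    sub_add_cancel] at hI
  rw [expSumError_eq hpos hmono hfin A hx t]
  refine (norm_add_le _ _).trans ?_
  rw [norm_mul, norm_cpow_neg_I_mul hx0, mul_one, Complex.norm_real, Real.norm_eq_abs, norm_mul,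
    norm_mul, Complex.norm_I, one_mul, Complex.norm_real, Real.norm_eq_abs]
  have h0 : 0 ≤ n 0 ^ α := Real.rpow_nonneg (hpos 0).le _
  have h1 : C * ((x ^ α - n 0 ^ α) / α) ≤ C * (x ^ α / α) := by gcongr; linarith
  calc _ ≤ C * x ^ α + |t| * (C * (x ^ α / α)) := by
        gcongr
        · exact hE x hx
        · exact hI.trans h1
    _ = _ := by ring

theorem measurable_expSumError {n : ℕ → ℝ} (hmono : Monotone n)
    (hfin : ∀ x, {j | n j ≤ x}.Finite) (A t : ℝ) : Measurable (expSumError n A t) := by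
  refine (measurable_expSum hmono hfin t).sub (measurable_const.mul ?_)
  exact (intervalIntegral.continuous_primitive (fun a b =>
    intervalIntegral.intervalIntegrable_cpow' (by simp)) _).measurable

/-! ### The integral representation and the analytic continuation. -/

theorem integral_main_term {a : ℝ} (ha : 0 < a) (t : ℝ) {w : ℂ} (hw : 1 < w.re) :
    MeasureTheory.IntegrableOn (fun u : ℝ => (∫ v in a..u, (v : ℂ) ^ (-(Complex.I * (t : ℂ))))
      * (u : ℂ) ^ (-w - 1)) (Set.Ioi a) ∧
    w * ∫ u in Set.Ioi a, (∫ v in a..u, (v : ℂ) ^ (-(Complex.I * (t : ℂ)))) * (u : ℂ) ^ (-w - 1)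
      = (a : ℂ) ^ (1 - (w + Complex.I * t)) / (w + Complex.I * t - 1) := by
  have h0 := one_sub_I_mul_ne_zero t
  have ha0 : (a : ℂ) ≠ 0 := by exact_mod_cast ha.ne'
  have hw0 : w ≠ 0 := fun h => by simp [h] at hw; linarith
  have hwt : w + Complex.I * t - 1 ≠ 0 := fun h => by
    have := congrArg Complex.re h
    simp at this; linarith
  have hr1 : (-w - Complex.I * t).re < -1 := by simp; linarith
  have hr2 : (-w - 1).re < -1 := by simp; linarith
  have hi1 := integrableOn_Ioi_cpow_of_lt hr1 ha
  have hi2 := (integrableOn_Ioi_cpow_of_lt hr2 ha).const_mul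
    (a * (a : ℂ) ^ (-(Complex.I * (t : ℂ))))
  have hcongr : Set.EqOn (fun u : ℝ => (∫ v in a..u, (v : ℂ) ^ (-(Complex.I * (t : ℂ))))
      * (u : ℂ) ^ (-w - 1)) (fun u : ℝ => (1 - Complex.I * t)⁻¹ * ((u : ℂ) ^ (-w - Complex.I * t)
        - a * (a : ℂ) ^ (-(Complex.I * (t : ℂ))) * (u : ℂ) ^ (-w - 1))) (Set.Ioi a) := by
    intro u hu
    have hu0 : (u : ℂ) ≠ 0 := by exact_mod_cast (ha.trans hu).ne'
    have h1 := integral_cpow_neg_I_mul ha (le_of_lt hu) t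
    have h2 : (u : ℂ) ^ (-w - Complex.I * t)
        = u * (u : ℂ) ^ (-(Complex.I * (t : ℂ))) * (u : ℂ) ^ (-w - 1) := by
      nth_rewrite 2 [← Complex.cpow_one (u : ℂ)]
      rw [← Complex.cpow_add _ _ hu0, ← Complex.cpow_add _ _ hu0]
      congr 1; ring
    simp only
    rw [h2, ← sub_mul, ← h1]
    field_simp
  constructor
  · exact (MeasureTheory.integrableOn_congr_fun hcongr measurableSet_Ioi).2
      ((hi1.sub hi2).const_mul _)
  rw [MeasureTheory.setIntegral_congr_fun measurableSet_Ioi hcongr,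
    MeasureTheory.integral_const_mul, MeasureTheory.integral_sub hi1 hi2,
    MeasureTheory.integral_const_mul, integral_Ioi_cpow_of_lt hr1 ha,
    integral_Ioi_cpow_of_lt hr2 ha, sub_add_cancel]
  have h3 : (a : ℂ) ^ (-w - Complex.I * t + 1) = (a : ℂ) ^ (1 - (w + Complex.I * t)) := by
    congr 1; ring
  have h4 : (a * (a : ℂ) ^ (-(Complex.I * (t : ℂ)))) * (a : ℂ) ^ (-w)
      = (a : ℂ) ^ (1 - (w + Complex.I * t)) := by
    nth_rewrite 1 [← Complex.cpow_one (a : ℂ)]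
    rw [← Complex.cpow_add _ _ ha0, ← Complex.cpow_add _ _ ha0]
    congr 1; ring
  have h5 : -w - Complex.I * t + 1 = -(w + Complex.I * t - 1) := by ring
  rw [h3, h5, mul_div_assoc', mul_neg, h4]
  field_simp
  ring

theorem hasSum_cpow_eq_integral_expSumError {n : ℕ → ℝ} (hpos : ∀ j, 0 < n j)
    (hmono : Monotone n) (hfin : ∀ x, {j | n j ≤ x}.Finite) {K : ℝ} (hK0 : 0 < K)
    (hK : ∀ x, n 0 ≤ x → countingFunction n x ≤ K * x) (A t : ℝ) {w : ℂ} (hw : 1 < w.re) :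
    HasSum (fun j => (n j : ℂ) ^ (-(w + Complex.I * t)))
      (A * (n 0 : ℂ) ^ (1 - (w + Complex.I * t)) / (w + Complex.I * t - 1)
        + w * ∫ u in Set.Ioi (n 0), expSumError n A t u * (u : ℂ) ^ (-w - 1)) := by
  have h := hasSum_mul_cpow_eq_integral_expSum hpos hmono hfin hK0 hK t hw
  obtain ⟨hi, hm⟩ := integral_main_term (hpos 0) t hw
  have hS : MeasureTheory.IntegrableOn (fun u : ℝ => expSum n u t * (u : ℂ) ^ (-w - 1))
      (Set.Ioi (n 0)) :=
    integrableOn_mul_cpow (measurable_expSum hmono hfin t) (hpos 0) (M := K) (α := 1)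
      (fun u hu => by
        rw [Real.rpow_one]; exact (expSum_norm_le hpos hfin u t).trans (hK u hu)) hw
  convert h using 1
  have : ∀ u : ℝ, expSumError n A t u * (u : ℂ) ^ (-w - 1) = expSum n u t * (u : ℂ) ^ (-w - 1)
      - A * ((∫ v in (n 0)..u, (v : ℂ) ^ (-(Complex.I * (t : ℂ)))) * (u : ℂ) ^ (-w - 1)) :=
    fun u => by rw [expSumError]; ring
  simp_rw [this]
  rw [MeasureTheory.integral_sub hS (hi.const_mul _), MeasureTheory.integral_const_mul,
    mul_div_assoc, ← hm]
  ring

theorem counting_shifted_bound {n : ℕ → ℝ} (hpos : 0 < n 0) {A θ C : ℝ} (hA : 0 < A)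
    (hC : 0 < C) (hθ : 0 ≤ θ)
    (hE : ∀ x, n 0 ≤ x → |countingFunction n x - A * x| ≤ C * x ^ θ) :
    ∃ C', 0 < C' ∧ ∀ x, n 0 ≤ x → |countingFunction n x - A * (x - n 0)| ≤ C' * x ^ θ := by
  have h0 : 0 < n 0 ^ (0 - θ) := Real.rpow_pos_of_pos hpos _
  refine ⟨C + A * n 0 * n 0 ^ (0 - θ), by positivity, fun x hx => ?_⟩
  have h1 := rpow_le_rpow_mul_rpow_of_le hpos hx hθ
  rw [Real.rpow_zero] at h1
  have h2 := mul_le_mul_of_nonneg_left h1 (mul_pos hA hpos).le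
  calc |countingFunction n x - A * (x - n 0)| = |(countingFunction n x - A * x) + A * n 0| := by
        congr 1; ring
    _ ≤ |countingFunction n x - A * x| + |A * n 0| := abs_add_le _ _
    _ ≤ C * x ^ θ + A * n 0 := by
        rw [abs_of_pos (mul_pos hA hpos)]; gcongr; exact hE x hx
    _ ≤ _ := by linarith

theorem bound_rpow_mono {n : ℕ → ℝ} (hpos : 0 < n 0) {f : ℝ → ℝ} {C α β : ℝ} (hC : 0 < C)
    (hαβ : α ≤ β) (h : ∀ x, n 0 ≤ x → f x ≤ C * x ^ α) :
    ∃ C', 0 < C' ∧ ∀ x, n 0 ≤ x → f x ≤ C' * x ^ β :=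
  ⟨C * n 0 ^ (α - β), mul_pos hC (Real.rpow_pos_of_pos hpos _), fun x hx => (h x hx).trans (by
    rw [mul_assoc]; gcongr; exact rpow_le_rpow_mul_rpow_of_le hpos hx hαβ)⟩

/-- The representation at t = 0 is used as the definition of Z. There R_0 is exactly N(x) - A(x - n
0), so the bound x^θ holds without loss and the whole half-plane is reached, even for θ = 0. The
pole term minus A/(s-1) is a difference quotient, made entire by `dslope`. -/
theorem exists_isZetaContinuation {n : ℕ → ℝ} (hpos : ∀ j, 0 < n j)
    (hmono : Monotone n) (hfin : ∀ x, {j | n j ≤ x}.Finite) {K : ℝ} (hK0 : 0 < K)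
    (hK : ∀ x, n 0 ≤ x → countingFunction n x ≤ K * x) {A θ C : ℝ}
    (hE : ∀ x, n 0 ≤ x → |countingFunction n x - A * (x - n 0)| ≤ C * x ^ θ) :
    ∃ Z, IsZetaContinuation n A θ Z := by
  have hn0 : (n 0 : ℂ) ≠ 0 := by exact_mod_cast (hpos 0).ne'
  set H : ℂ → ℂ := fun s => s * ∫ u in Set.Ioi (n 0), expSumError n A 0 u * (u : ℂ) ^ (-s - 1)
  have hH : DifferentiableOn ℂ H {s | θ < s.re} := fun s hs =>
    (differentiableAt_id.mul (differentiableAt_integral_mul_cpow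
      (measurable_expSumError hmono hfin A 0) (hpos 0) (M := C) (α := θ) (fun u hu => by
        rw [expSumError_zero_right A hfin, Complex.norm_real]; exact hE u hu)
        hs)).differentiableWithinAt
  refine ⟨fun s => A * (n 0 : ℂ) ^ (1 - s) / (s - 1) + H s, fun s hs => ?_,
    fun s => A * dslope (fun s => (n 0 : ℂ) ^ (1 - s)) 1 s + H s, ?_, fun s _ h1 => ?_⟩
  · simpa using hasSum_cpow_eq_integral_expSumError hpos hmono hfin hK0 hK A 0 hs
  · refine DifferentiableOn.add (DifferentiableOn.const_mul ?_ _) hH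
    have : DifferentiableOn ℂ (fun s : ℂ => (n 0 : ℂ) ^ (1 - s)) Set.univ := fun s _ =>
      ((differentiableAt_id.const_sub 1).const_cpow (Or.inl hn0)).differentiableWithinAt
    exact ((Complex.differentiableOn_dslope univ_mem).2 this).mono (Set.subset_univ _)
  · have h2 : s - 1 ≠ 0 := sub_ne_zero.2 h1
    simp only [dslope_of_ne _ h1, slope_def_field, sub_self, Complex.cpow_zero]
    field_simp
    ring

/-- For fixed t both sides, multiplied by s - 1 to remove the pole, are analytic in w on Re w > θ
and agree far to the right, where the series converges. -/
theorem IsZetaContinuation.apply_eq {n : ℕ → ℝ} (hpos : ∀ j, 0 < n j)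
    (hmono : Monotone n) (hfin : ∀ x, {j | n j ≤ x}.Finite) {K : ℝ} (hK0 : 0 < K)
    (hK : ∀ x, n 0 ≤ x → countingFunction n x ≤ K * x) {A θ C : ℝ} (hθ : 0 ≤ θ) (hC : 0 < C)
    (hE : ∀ x, n 0 ≤ x → |countingFunction n x - A * (x - n 0)| ≤ C * x ^ θ)
    {Z : ℂ → ℂ} (hZ : IsZetaContinuation n A θ Z) (t : ℝ) {w : ℂ} (hw : θ < w.re)
    (hw1 : w + Complex.I * t ≠ 1) :
    Z (w + Complex.I * t) = A * (n 0 : ℂ) ^ (1 - (w + Complex.I * t)) / (w + Complex.I * t - 1)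
      + w * ∫ u in Set.Ioi (n 0), expSumError n A t u * (u : ℂ) ^ (-w - 1) := by
  obtain ⟨G, hG, hGZ⟩ := hZ.continuation
  have hn0 : (n 0 : ℂ) ≠ 0 := by exact_mod_cast (hpos 0).ne'
  set U : Set ℂ := {s | θ < s.re}
  have hU : IsOpen U := isOpen_lt continuous_const Complex.continuous_re
  have hUc : IsPreconnected U := (convex_halfSpace_re_gt θ).isPreconnected
  have hre : ∀ s : ℂ, (s + Complex.I * t).re = s.re := fun s => by simp
  set f : ℂ → ℂ := fun s => (s + Complex.I * t - 1) * G (s + Complex.I * t) + A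
  set g : ℂ → ℂ := fun s => A * (n 0 : ℂ) ^ (1 - (s + Complex.I * t)) + (s + Complex.I * t - 1) *
      (s * ∫ u in Set.Ioi (n 0), expSumError n A t u * (u : ℂ) ^ (-s - 1))
  have hshift : Differentiable ℂ fun s : ℂ => s + Complex.I * t :=
    differentiable_id.add_const _
  have hf : DifferentiableOn ℂ f U :=
    ((hshift.sub_const 1).differentiableOn.mul (hG.comp hshift.differentiableOn fun s hs => by
      simpa [U] using hs)).add_const _
  have hg : DifferentiableOn ℂ g U := fun s hs => by
    have hs' : θ < s.re := hs
    -- The bound on R_t needs a positive exponent, which θ need not be; an α strictly between θ and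
    -- Re s serves.
    obtain ⟨α, hα1, hα2⟩ := exists_between hs'
    obtain ⟨C', hC', hE'⟩ := bound_rpow_mono (hpos 0) hC hα1.le hE
    have hd := differentiableAt_integral_mul_cpow
      (measurable_expSumError hmono hfin A t) (hpos 0) (fun u hu =>
        expSumError_bound hpos hmono hfin hu t (hθ.trans_lt hα1) hE') hα2
    exact ((((hshift s).const_sub 1).const_cpow (Or.inl hn0)).const_mul _ |>.add
      (((hshift s).sub_const 1).mul (differentiableAt_id.mul hd))).differentiableWithinAt
  have hmem : ((2 + |θ| : ℝ) : ℂ) ∈ U := by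
    simp only [U, Set.mem_ofPred_eq, Complex.ofReal_re]; linarith [le_abs_self θ]
  have hne1 : ∀ s : ℂ, 1 < s.re → s + Complex.I * t - 1 ≠ 0 := fun s hs h => by
    have := congrArg Complex.re h
    simp at this; linarith
  have hev : f =ᶠ[nhds ((2 + |θ| : ℝ) : ℂ)] g := by
    have hV : {s : ℂ | max 1 θ < s.re} ∈ nhds ((2 + |θ| : ℝ) : ℂ) := by
      refine (isOpen_lt continuous_const Complex.continuous_re).mem_nhds ?_
      simp only [Set.mem_ofPred_eq, Complex.ofReal_re, max_lt_iff]
      constructor <;> linarith [le_abs_self θ, abs_nonneg θ]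
    filter_upwards [hV] with s hs
    obtain ⟨hs1, hsθ⟩ := max_lt_iff.1 hs
    have h1 := hne1 s hs1
    have h2 := hGZ (s + Complex.I * t) (by rw [hre]; exact hsθ) (sub_ne_zero.1 h1)
    have h3 := (hZ.hasSum (s + Complex.I * t) (by rw [hre]; exact hs1)).unique
      (hasSum_cpow_eq_integral_expSumError hpos hmono hfin hK0 hK A t hs1)
    simp only [f, g]
    rw [← h2, h3]
    field_simp
    ring
  have hfg := (hf.analyticOnNhd hU).eqOn_of_preconnected_of_eventuallyEq (hg.analyticOnNhd hU)
    hUc hmem hev hw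
  have h1 : w + Complex.I * t - 1 ≠ 0 := sub_ne_zero.2 hw1
  have h2 := hGZ (w + Complex.I * t) (by rw [hre]; exact hw) hw1
  simp only [f, g] at hfg
  rw [← h2] at hfg
  field_simp at hfg ⊢
  linear_combination hfg

/-! ### From the Lindelöf hypothesis to the critical line. -/

theorem IsZetaContinuation.continuous_critical_line {n : ℕ → ℝ} {A θ : ℝ} (hθ : θ < 1 / 2)
    {Z : ℂ → ℂ} (hZ : IsZetaContinuation n A θ Z) :
    Continuous fun τ : ℝ => Z (1 / 2 + Complex.I * (τ : ℂ)) := by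
  obtain ⟨G, hG, hGZ⟩ := hZ.continuation
  have hre : ∀ τ : ℝ, (1 / 2 + Complex.I * (τ : ℂ)).re = 1 / 2 := fun τ => by simp
  have hne : ∀ τ : ℝ, 1 / 2 + Complex.I * (τ : ℂ) ≠ 1 := fun τ h => by
    have := congrArg Complex.re h
    rw [hre] at this; norm_num at this
  have hline : Continuous fun τ : ℝ => 1 / 2 + Complex.I * (τ : ℂ) := by fun_prop
  have : (fun τ : ℝ => Z (1 / 2 + Complex.I * (τ : ℂ))) = fun τ : ℝ =>
      G (1 / 2 + Complex.I * (τ : ℂ)) + A / (1 / 2 + Complex.I * (τ : ℂ) - 1) := by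
    funext τ
    rw [← hGZ _ (by rw [hre]; exact hθ) (hne τ)]; ring
  rw [this]
  refine (hG.continuousOn.comp_continuous hline fun τ => by
    simp only [Set.mem_ofPred_eq, hre]; exact hθ).add
    (continuous_const.div (hline.sub continuous_const) fun τ => sub_ne_zero.2 (hne τ))

theorem norm_main_term_le {a A : ℝ} (ha : 0 < a) (hA : 0 < A) (τ : ℝ) :
    ‖A * (a : ℂ) ^ (1 - (1 / 2 + Complex.I * τ)) / (1 / 2 + Complex.I * τ - 1)‖
      ≤ 2 * A * a ^ (1 / 2 : ℝ) := by
  have h1 : 1 / 2 ≤ ‖1 / 2 + Complex.I * (τ : ℂ) - 1‖ := by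
    refine le_trans ?_ (Complex.abs_re_le_norm _)
    simp; norm_num
  rw [norm_div, norm_mul, Complex.norm_cpow_eq_rpow_re_of_pos ha, Complex.norm_real,
    Real.norm_of_nonneg hA.le, div_le_iff₀ (by linarith)]
  have h2 : (1 - (1 / 2 + Complex.I * (τ : ℂ))).re = 1 / 2 := by simp; norm_num
  rw [h2]
  have h3 : 0 ≤ A * a ^ (1 / 2 : ℝ) := by positivity
  nlinarith

theorem critical_line_of_lindelofHypothesis {n : ℕ → ℝ} (hpos : ∀ j, 0 < n j)
    (hmono : Monotone n) (hfin : ∀ x, {j | n j ≤ x}.Finite) {K : ℝ} (hK0 : 0 < K)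
    (hK : ∀ x, n 0 ≤ x → countingFunction n x ≤ K * x) {A θ C : ℝ} (hA : 0 < A) (hθ : 0 ≤ θ)
    (hθ₁ : θ < 1 / 2) (hC : 0 < C)
    (hE : ∀ x, n 0 ≤ x → |countingFunction n x - A * (x - n 0)| ≤ C * x ^ θ)
    {Z : ℂ → ℂ} (hZ : IsZetaContinuation n A θ Z)
    (hLH : LindelofHypothesis n (fun x => A * x)) {ε : ℝ} (hε : 0 < ε) :
    (fun τ : ℝ => Z (1 / 2 + Complex.I * (τ : ℂ))) =O[cocompact ℝ] fun τ : ℝ => |τ| ^ ε := by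
  rw [lindelofHypothesis_iff] at hLH
  obtain ⟨α, hα1, hα2⟩ := exists_between hθ₁
  have hα0 : 0 < α := hθ.trans_lt hα1
  obtain ⟨C', hC', hE'⟩ := bound_rpow_mono (hpos 0) hC hα1.le hE
  -- Chosen so that α + η - 3/2 = -1 - η. With B = 1/η, the range u ≥ |t|^B gives |t| ≤ u^η, and the
  -- tail integrand is O(u^(-1-η)).
  set η := (1 / 2 - α) / 2 with hη
  have hη0 : 0 < η := by linarith
  set B := 1 / η with hB
  have hB0 : 0 < B := by positivity
  -- For u ≤ |t|^B the hypothesis only gives u^(-1). Writing this as u^κ u^(-1-κ), with u^κ ≤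
  -- |t|^(Bκ) ≤ |t|^(ε/2), gains integrability; κ ≤ η lets the same majorant cover the tail.
  set κ := min η (ε / 2 / B) with hκ
  have hκ0 : 0 < κ := by positivity
  have hκη : κ ≤ η := min_le_left _ _
  have hκB : B * κ ≤ ε / 2 := by
    have := mul_le_mul_of_nonneg_left (min_le_right η (ε / 2 / B)) hB0.le
    rwa [mul_div_cancel₀ _ hB0.ne'] at this
  obtain ⟨C₁, hC₁⟩ := hLH (ε / 2) B (by positivity) hB0
  set D := |C₁| * A ^ (1 / 2 : ℝ) + C' * (1 + 1 / α) with hD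
  have hD1 : 0 ≤ C' * (1 + 1 / α) := by positivity
  have hD2 : 0 ≤ |C₁| * A ^ (1 / 2 : ℝ) := by positivity
  have key : ∀ t : ℝ, 1 ≤ |t| → ∀ u, n 0 < u →
      ‖expSumError n A t u‖ * u ^ (-(3 / 2) : ℝ) ≤ D * |t| ^ ε * u ^ (-1 - κ) := by
    intro t ht u hu
    have hu0 : 0 < u := (hpos 0).trans hu
    have ht0 : 0 < |t| := by linarith
    rcases le_total u (|t| ^ B) with h | h
    · have h1 := hC₁ u t hu.le h
      rw [Real.mul_rpow hA.le hu0.le] at h1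
      have h2 : u ^ κ ≤ |t| ^ (ε / 2) := by
        calc u ^ κ ≤ (|t| ^ B) ^ κ := by gcongr
          _ = |t| ^ (B * κ) := (Real.rpow_mul ht0.le _ _).symm
          _ ≤ _ := Real.rpow_le_rpow_of_exponent_le ht hκB
      calc ‖expSumError n A t u‖ * u ^ (-(3 / 2) : ℝ)
          ≤ (C₁ * (A ^ (1 / 2 : ℝ) * u ^ (1 / 2 : ℝ) * |t| ^ (ε / 2))) * u ^ (-(3 / 2) : ℝ) := by
            gcongr
        _ ≤ (|C₁| * (A ^ (1 / 2 : ℝ) * u ^ (1 / 2 : ℝ) * |t| ^ (ε / 2))) * u ^ (-(3 / 2) : ℝ) := by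
            gcongr; exact le_abs_self _
        _ = |C₁| * A ^ (1 / 2 : ℝ) * |t| ^ (ε / 2) * (u ^ κ * u ^ (-1 - κ)) := by
            have : u ^ κ * u ^ (-1 - κ) = u ^ (1 / 2 : ℝ) * u ^ (-(3 / 2) : ℝ) := by
              rw [← Real.rpow_add hu0, ← Real.rpow_add hu0]; norm_num
            rw [this]; ring
        _ ≤ |C₁| * A ^ (1 / 2 : ℝ) * |t| ^ (ε / 2) * (|t| ^ (ε / 2) * u ^ (-1 - κ)) := by
            gcongr
        _ = |C₁| * A ^ (1 / 2 : ℝ) * |t| ^ ε * u ^ (-1 - κ) := by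
            rw [← add_halves ε, Real.rpow_add ht0]; simp only [add_halves]; ring
        _ ≤ _ := by gcongr; linarith
    · have h1 := expSumError_bound hpos hmono hfin hu.le t hα0 hE'
      have hu1 : 1 ≤ u := (Real.one_le_rpow ht hB0.le).trans h
      have h2 : |t| ≤ u ^ η := by
        calc |t| = (|t| ^ B) ^ η := by
              rw [← Real.rpow_mul ht0.le, hB, one_div_mul_cancel hη0.ne', Real.rpow_one]
          _ ≤ _ := by gcongr
      have h3 : 1 + |t| / α ≤ (1 + 1 / α) * u ^ η := by
        have : 1 ≤ u ^ η := ht.trans h2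
        have : |t| / α ≤ u ^ η / α := by gcongr
        rw [add_mul, one_mul, one_div_mul_eq_div]; linarith
      have h4 : 1 ≤ |t| ^ ε := Real.one_le_rpow ht hε.le
      calc ‖expSumError n A t u‖ * u ^ (-(3 / 2) : ℝ)
          ≤ C' * ((1 + 1 / α) * u ^ η) * u ^ α * u ^ (-(3 / 2) : ℝ) := by
            gcongr; exact h1.trans (by gcongr)
        _ = C' * (1 + 1 / α) * 1 * u ^ (-1 - η) := by
            have : u ^ (-1 - η) = u ^ η * u ^ α * u ^ (-(3 / 2) : ℝ) := by
              rw [← Real.rpow_add hu0, ← Real.rpow_add hu0]; congr 1; rw [hη]; ring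
            rw [this]; ring
        _ ≤ D * |t| ^ ε * u ^ (-1 - κ) := by
            gcongr
            linarith
  set J := ∫ u in Set.Ioi (n 0), u ^ (-1 - κ) with hJ
  refine IsBigO.of_bound (2 * A * n 0 ^ (1 / 2 : ℝ) + 1 / 2 * (D * J)) ?_
  filter_upwards [(tendsto_norm_cocompact_atTop (E := ℝ)).eventually_ge_atTop 1] with t ht
  rw [Real.norm_eq_abs] at ht
  have hne : (1 / 2 : ℂ) + Complex.I * t ≠ 1 := fun h => by
    have := congrArg Complex.re h
    norm_num at this
  rw [hZ.apply_eq hpos hmono hfin hK0 hK hθ hC hE t (by simpa using hθ₁) hne,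
    Real.norm_of_nonneg (Real.rpow_nonneg (abs_nonneg t) ε)]
  have h4 : 1 ≤ |t| ^ ε := Real.one_le_rpow ht hε.le
  have hI : ‖∫ u in Set.Ioi (n 0), expSumError n A t u * (u : ℂ) ^ (-(1 / 2 : ℂ) - 1)‖
      ≤ ∫ u in Set.Ioi (n 0), D * |t| ^ ε * u ^ (-1 - κ) := by
    refine MeasureTheory.norm_integral_le_of_norm_le
      ((integrableOn_Ioi_rpow_of_lt (by linarith) (hpos 0)).const_mul _) ?_
    filter_upwards [MeasureTheory.ae_restrict_mem measurableSet_Ioi] with u hu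
    rw [norm_mul, Complex.norm_cpow_eq_rpow_re_of_pos ((hpos 0).trans hu)]
    have : (-(1 / 2 : ℂ) - 1).re = -(3 / 2) := by norm_num
    rw [this]
    exact key t ht u hu
  rw [MeasureTheory.integral_const_mul, ← hJ] at hI
  refine (norm_add_le _ _).trans ?_
  rw [norm_mul, add_mul]
  have h5 : ‖(1 / 2 : ℂ)‖ = 1 / 2 := by norm_num
  rw [h5]
  have h6 : 0 ≤ 2 * A * n 0 ^ (1 / 2 : ℝ) := by have := hpos 0; positivity
  have h7 := norm_main_term_le (hpos 0) hA t
  refine add_le_add (h7.trans (le_mul_of_one_le_right h6 h4)) ?_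
  calc _ ≤ 1 / 2 * (D * |t| ^ ε * J) := by gcongr
    _ = _ := by ring

/-! ### From the critical line to the Lindelöf hypothesis: smoothing on a logarithmic scale. -/

-- Expanding the window by the Fourier integral and applying Fubini turns a local average of f
-- around e^y into an integral of its Mellin transform along a vertical line.
open MeasureTheory FourierTransform in
theorem integral_mul_fourier_log {f : ℝ → ℂ} {a : ℝ} (ha : 0 < a)
    (hf : IntegrableOn f (Set.Ioi a)) {g : ℝ → ℂ} (hg : Integrable g) {δ : ℝ} (hδ : 0 < δ)
    (y : ℝ) :
    ∫ u in Set.Ioi a, f u * 𝓕 g ((Real.log u - y) / δ)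
      = δ * ∫ ξ : ℝ, Complex.exp ((2 * Real.pi * ξ * y : ℝ) * Complex.I) * g (δ * ξ)
          * ∫ u in Set.Ioi a, f u * (u : ℂ) ^ (-(2 * Real.pi * ξ : ℝ) * Complex.I) := by
  have hgδ : Integrable fun ξ => g (δ * ξ) := hg.comp_mul_left' hδ.ne'
  set k : ℝ → ℝ → ℂ := fun u ξ => Complex.exp ((2 * Real.pi * ξ * (y - Real.log u) : ℝ) * Complex.I)
  have hk : Measurable (Function.uncurry k) := by
    simp only [k, Function.uncurry_def]
    fun_prop
  have hk1 : ∀ u ξ, ‖k u ξ‖ = 1 := fun u ξ => Complex.norm_exp_ofReal_mul_I _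
  have hleft : ∀ u, f u * 𝓕 g ((Real.log u - y) / δ)
      = δ * ∫ ξ, f u * g (δ * ξ) * k u ξ := fun u => by
    have h1 : 𝓕 g ((Real.log u - y) / δ) = ∫ η, (k u (η / δ)) * g η := by
      rw [Real.fourier_eq']
      refine integral_congr_ae (ae_of_all _ fun η => ?_)
      simp only [k, smul_eq_mul, RCLike.inner_apply, conj_trivial]
      congr 4
      field_simp
      ring
    have h2 := Measure.integral_comp_mul_left (fun η => k u (η / δ) * g η) δ
    simp only [mul_div_cancel_left₀ _ hδ.ne'] at h2
    have h3 : ∀ ξ, f u * g (δ * ξ) * k u ξ = f u * (k u ξ * g (δ * ξ)) := fun ξ => by ring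
    simp_rw [h3]
    rw [integral_const_mul, h2, h1, abs_of_pos (inv_pos.2 hδ), Complex.real_smul]
    have : (δ : ℂ) ≠ 0 := by exact_mod_cast hδ.ne'
    push_cast
    field_simp
  have hint : Integrable (Function.uncurry fun u ξ => f u * g (δ * ξ) * k u ξ)
      ((volume.restrict (Set.Ioi a)).prod volume) :=
    (hf.mul_prod hgδ).mul_bdd (c := 1) hk.aestronglyMeasurable
      (ae_of_all _ fun p => (hk1 p.1 p.2).le)
  simp_rw [hleft]
  rw [integral_const_mul, integral_integral_swap hint]
  congr 1
  refine integral_congr_ae (ae_of_all _ fun ξ => ?_)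
  beta_reduce
  rw [← integral_const_mul]
  refine setIntegral_congr_fun measurableSet_Ioi fun u hu => ?_
  have hu0 : 0 < u := ha.trans hu
  have : k u ξ = Complex.exp ((2 * Real.pi * ξ * y : ℝ) * Complex.I)
      * (u : ℂ) ^ (-(2 * Real.pi * ξ : ℝ) * Complex.I) := by
    rw [Complex.cpow_def_of_ne_zero (by exact_mod_cast hu0.ne'), ← Complex.ofReal_log hu0.le,
      ← Complex.exp_add]
    simp only [k]
    congr 1
    push_cast
    ring
  rw [this]
  ring

/-- A smooth bump function on `ℝ`, supported in `(0, 1)` and equal to `1` on `[1/4, 3/4]`. -/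
noncomputable def unitBump : ContDiffBump (1 / 2 : ℝ) := ⟨1 / 4, 1 / 2, by norm_num, by norm_num⟩

-- Here r is compared with the average of u f(u) against the weight p(u)/u, p being the bump in log
-- u. Its mass is at least δ/2, since p = 1 on the middle half of the window in log u; dividing by
-- the mass produces 2/δ.
open MeasureTheory in
theorem norm_le_of_smoothed {f : ℝ → ℂ} {a x δ M : ℝ} (ha : 0 < a) (hx : a ≤ x) (hδ : 0 < δ)
    (hf : IntegrableOn f (Set.Ioi a)) (r : ℂ)
    (hM : ∀ u, x ≤ u → u ≤ x * Real.exp δ → ‖u * f u - r‖ ≤ M) :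
    ‖r‖ ≤ M + 2 / δ *
      ‖∫ u in Set.Ioi a, f u * (unitBump ((Real.log u - Real.log x) / δ) : ℂ)‖ := by
  have hx0 : 0 < x := ha.trans_le hx
  set p : ℝ → ℝ := fun u => unitBump ((Real.log u - Real.log x) / δ) with hp
  have hp0 : ∀ u, 0 ≤ p u := fun u => unitBump.nonneg
  have hp1 : ∀ u, p u ≤ 1 := fun u => unitBump.le_one
  have hpm : Measurable p :=
    unitBump.continuous.measurable.comp ((Real.measurable_log.sub_const _).div_const _)
  have hsupp : ∀ u, 0 < u → p u ≠ 0 → x ≤ u ∧ u ≤ x * Real.exp δ := by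
    intro u hu h
    have h1 : (Real.log u - Real.log x) / δ ∈ Function.support unitBump := h
    rw [unitBump.support_eq, Metric.mem_ball, Real.dist_eq, abs_lt] at h1
    have h2 : unitBump.rOut = 1 / 2 := rfl
    rw [h2] at h1
    have h3 : 0 < (Real.log u - Real.log x) / δ := by linarith [h1.1]
    have h4 : (Real.log u - Real.log x) / δ < 1 := by linarith [h1.2]
    rw [div_lt_one hδ] at h4
    have h5 := (div_pos_iff_of_pos_right hδ).1 h3
    constructor
    · exact (Real.log_le_log_iff hx0 hu).1 (by linarith)
    · rw [← Real.exp_log hu, ← Real.exp_log hx0, ← Real.exp_add]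
      exact Real.exp_le_exp.2 (by linarith)
  set q : ℝ → ℝ := fun u => p u / u with hq
  have hqm : Measurable q := hpm.div measurable_id
  have hqint : IntegrableOn q (Set.Ioi a) := by
    have h1 : IntegrableOn (fun _ : ℝ => (1 / x : ℝ)) (Set.Icc x (x * Real.exp δ)) :=
      integrableOn_const (by simp)
    refine ((integrable_indicator_iff measurableSet_Icc).2 h1).integrableOn.mono'
      hqm.aestronglyMeasurable ?_
    filter_upwards [ae_restrict_mem measurableSet_Ioi] with u hu
    have hu0 : 0 < u := ha.trans hu
    rw [Real.norm_of_nonneg (div_nonneg (hp0 u) hu0.le)]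
    by_cases h : p u = 0
    · simp only [h, zero_div]
      exact Set.indicator_nonneg (fun _ _ => by positivity) _
    · have h2 := hsupp u hu0 h
      rw [Set.indicator_of_mem (Set.mem_Icc.2 h2)]
      exact div_le_div₀ zero_le_one (hp1 u) hx0 h2.1
  set Q := ∫ u in Set.Ioi a, q u with hQ
  have hQδ : δ / 2 ≤ Q := by
    have hl : x * Real.exp (δ / 4) ≤ x * Real.exp (3 * δ / 4) := by gcongr; linarith
    have hsub : Set.Ioc (x * Real.exp (δ / 4)) (x * Real.exp (3 * δ / 4)) ⊆ Set.Ioi a :=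
      fun u hu => hx.trans_lt (lt_of_le_of_lt (le_mul_of_one_le_right hx0.le
        (Real.one_le_exp (by positivity))) hu.1)
    have h1 : ∫ u in Set.Ioc (x * Real.exp (δ / 4)) (x * Real.exp (3 * δ / 4)), q u ≤ Q :=
      setIntegral_mono_set hqint (by
        filter_upwards [ae_restrict_mem measurableSet_Ioi] with u hu
        exact div_nonneg (hp0 u) (ha.trans hu).le) hsub.eventuallyLE
    refine le_trans (le_of_eq ?_) h1
    have h2 : Set.EqOn q (fun u => u⁻¹)
        (Set.Ioc (x * Real.exp (δ / 4)) (x * Real.exp (3 * δ / 4))) := by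
      intro u hu
      have hu0 : 0 < u := (by positivity : 0 < x * Real.exp (δ / 4)).trans hu.1
      have h3 : Real.log x + δ / 4 ≤ Real.log u := by
        have := Real.log_le_log (by positivity) hu.1.le
        rwa [Real.log_mul hx0.ne' (Real.exp_ne_zero _), Real.log_exp] at this
      have h4 : Real.log u ≤ Real.log x + 3 * δ / 4 := by
        have := Real.log_le_log hu0 hu.2
        rwa [Real.log_mul hx0.ne' (Real.exp_ne_zero _), Real.log_exp] at this
      have h5 : p u = 1 := by
        refine unitBump.one_of_mem_closedBall ?_
        have h6 : unitBump.rIn = 1 / 4 := rfl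
        rw [Metric.mem_closedBall, Real.dist_eq, abs_le, h6]
        constructor
        · have : 1 / 4 ≤ (Real.log u - Real.log x) / δ := by rw [le_div_iff₀ hδ]; linarith
          linarith
        · have : (Real.log u - Real.log x) / δ ≤ 3 / 4 := by rw [div_le_iff₀ hδ]; linarith
          linarith
      simp [hq, h5]
    rw [setIntegral_congr_fun measurableSet_Ioc h2, ← intervalIntegral.integral_of_le hl,
      integral_inv_of_pos (by positivity) (by positivity), mul_div_mul_left _ _ hx0.ne',
      ← Real.exp_sub, Real.log_exp]
    ring
  have hfp : IntegrableOn (fun u => f u * (p u : ℂ)) (Set.Ioi a) :=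
    hf.mul_bdd (c := 1) (Complex.measurable_ofReal.comp hpm).aestronglyMeasurable
      (ae_of_all _ fun u => by
        rw [Complex.norm_real, Real.norm_of_nonneg (hp0 u)]; exact hp1 u)
  have hrq : IntegrableOn (fun u => r * (q u : ℂ)) (Set.Ioi a) := hqint.ofReal.const_mul r
  have hdiff : ‖(∫ u in Set.Ioi a, f u * (p u : ℂ)) - r * Q‖ ≤ M * Q := by
    rw [hQ, ← integral_complex_ofReal, ← integral_const_mul, ← integral_sub hfp hrq,
      ← integral_const_mul M]
    refine norm_integral_le_of_norm_le (hqint.const_mul M) ?_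
    filter_upwards [ae_restrict_mem measurableSet_Ioi] with u hu
    have hu0 : 0 < u := ha.trans hu
    have huc : (u : ℂ) ≠ 0 := by exact_mod_cast hu0.ne'
    have h1 : f u * (p u : ℂ) - r * (q u : ℂ) = (u * f u - r) * (q u : ℂ) := by
      simp only [hq]; push_cast; field_simp
    have hqu : 0 ≤ q u := div_nonneg (hp0 u) hu0.le
    rw [h1, norm_mul, Complex.norm_real, Real.norm_of_nonneg hqu]
    by_cases h : p u = 0
    · simp [hq, h]
    · obtain ⟨h2, h3⟩ := hsupp u hu0 h
      exact mul_le_mul_of_nonneg_right (hM u h2 h3) hqu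
  have hQ0 : 0 < Q := by linarith
  set I := ∫ u in Set.Ioi a, f u * (p u : ℂ)
  have h1 : ‖r‖ * Q ≤ M * Q + ‖I‖ := by
    calc ‖r‖ * Q = ‖r * Q‖ := by rw [norm_mul, Complex.norm_real, Real.norm_of_nonneg hQ0.le]
      _ = ‖I - (I - r * Q)‖ := by congr 1; ring
      _ ≤ ‖I‖ + ‖I - r * Q‖ := norm_sub_le _ _
      _ ≤ _ := by linarith
  have h2 : ‖I‖ ≤ 2 / δ * ‖I‖ * Q := by
    have : 1 ≤ 2 / δ * Q := by rw [div_mul_eq_mul_div, one_le_div hδ]; linarith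
    nlinarith [norm_nonneg I]
  nlinarith

open MeasureTheory FourierTransform in
theorem exists_fourier_eq_unitBump : ∃ g : ℝ → ℂ, Integrable g ∧
    (∃ C, 0 < C ∧ ∀ η, ‖g η‖ * (1 + |η|) ≤ C) ∧ ∀ v, 𝓕 g v = (unitBump v : ℂ) := by
  have hc : HasCompactSupport fun v => (unitBump v : ℂ) :=
    unitBump.hasCompactSupport.comp_left Complex.ofReal_zero
  have hs : ContDiff ℝ (↑(⊤ : ℕ∞)) fun v => (unitBump v : ℂ) :=
    Complex.ofRealCLM.contDiff.comp unitBump.contDiff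
  set φ : SchwartzMap ℝ ℂ := hc.toSchwartzMap hs
  refine ⟨(𝓕⁻ φ : SchwartzMap ℝ ℂ), SchwartzMap.integrable _, ?_, fun v => ?_⟩
  · obtain ⟨C0, h0, hC0⟩ := (𝓕⁻ φ : SchwartzMap ℝ ℂ).decay 0 0
    obtain ⟨C1, h1, hC1⟩ := (𝓕⁻ φ : SchwartzMap ℝ ℂ).decay 1 0
    refine ⟨C0 + C1, by positivity, fun η => ?_⟩
    have e0 := hC0 η
    have e1 := hC1 η
    simp only [norm_iteratedFDeriv_zero, pow_zero, one_mul, pow_one, Real.norm_eq_abs] at e0 e1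
    linarith
  · rw [← SchwartzMap.fourier_coe, FourierTransform.fourier_fourierInv_eq]
    rfl

theorem exists_bound_of_isBigO_cocompact {f : ℝ → ℂ} (hf : Continuous f) {ε : ℝ} (hε : 0 ≤ ε)
    (h : f =O[cocompact ℝ] fun τ => |τ| ^ ε) :
    ∃ D, 0 < D ∧ ∀ τ, ‖f τ‖ ≤ D * (1 + |τ|) ^ ε := by
  obtain ⟨c, hc, hb⟩ := h.exists_pos
  obtain ⟨S, hS, hSc⟩ := mem_cocompact.1 hb.bound
  obtain ⟨c', hc'⟩ := hS.exists_bound_of_continuousOn hf.continuousOn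
  refine ⟨c + |c'|, by positivity, fun τ => ?_⟩
  have h1 : 1 ≤ (1 + |τ|) ^ ε := Real.one_le_rpow (by linarith [abs_nonneg τ]) hε
  by_cases hτ : τ ∈ S
  · have := hc' τ hτ
    have := le_abs_self c'
    nlinarith [abs_nonneg c']
  · have h2 : ‖f τ‖ ≤ c * ‖|τ| ^ ε‖ := hSc hτ
    rw [Real.norm_of_nonneg (Real.rpow_nonneg (abs_nonneg τ) ε)] at h2
    have h3 : |τ| ^ ε ≤ (1 + |τ|) ^ ε :=
      Real.rpow_le_rpow (abs_nonneg τ) (by linarith) hε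
    nlinarith [abs_nonneg c', mul_le_mul_of_nonneg_left h3 hc.le]

/-- The first term is R_t(u)/√u. The difference splits into (R_t(u) - R_t(x))/√x, where monotone
counting and the O(√x) error in N bound the increment by O(√x), and R_t(u)(1/√x - 1/√u), where the
trivial R_t(u) ≪ u suffices. -/
theorem norm_expSumError_mul_cpow_sub_le {n : ℕ → ℝ} (hpos : ∀ j, 0 < n j)
    (hfin : ∀ x, {j | n j ≤ x}.Finite) {K : ℝ}
    (hK : ∀ x, n 0 ≤ x → countingFunction n x ≤ K * x) {A C : ℝ} (hA : 0 < A) (hC : 0 < C)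
    (hE : ∀ x, n 0 ≤ x → |countingFunction n x - A * (x - n 0)| ≤ C * x ^ (1 / 2 : ℝ))
    (t : ℝ) {x u : ℝ} (hx : n 0 ≤ x) (hxu : x ≤ u) (hux : u ≤ x + 2 * √x) (hux' : u ≤ 4 * x) :
    ‖u * (expSumError n A t u * (u : ℂ) ^ (-(1 / 2 : ℂ) - 1)) - expSumError n A t x / (√x : ℂ)‖
      ≤ 6 * A + 3 * C + 2 * K := by
  have hx0 := (hpos 0).trans_le hx
  have hu0 := hx0.trans_le hxu
  set p := √u with hp
  set q := √x with hq
  have hq0 : 0 < q := Real.sqrt_pos.2 hx0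
  have hqp : q ≤ p := Real.sqrt_le_sqrt hxu
  have hp0 : 0 < p := hq0.trans_le hqp
  have hp2 : p * p = u := Real.mul_self_sqrt hu0.le
  have hq2 : q * q = x := Real.mul_self_sqrt hx0.le
  have hpq : p ≤ 2 * q := by nlinarith
  have h1 : u * (expSumError n A t u * (u : ℂ) ^ (-(1 / 2 : ℂ) - 1))
      = expSumError n A t u / (p : ℂ) := by
    have e1 : (u : ℂ) ^ (-(1 / 2 : ℂ) - 1) = ((u ^ (-(1 / 2) - 1 : ℝ) : ℝ) : ℂ) := by
      rw [Complex.ofReal_cpow hu0.le]; push_cast; rfl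
    have e2 : u * u ^ (-(1 / 2) - 1 : ℝ) = p⁻¹ := by
      rw [Real.rpow_sub_one hu0.ne', Real.rpow_neg hu0.le, ← Real.sqrt_eq_rpow, ← hp]
      field_simp
    rw [e1, mul_left_comm, ← Complex.ofReal_mul, e2, Complex.ofReal_inv, div_eq_mul_inv]
  set R := expSumError n A t with hR
  have hpc : (p : ℂ) ≠ 0 := by exact_mod_cast hp0.ne'
  have hqc : (q : ℂ) ≠ 0 := by exact_mod_cast hq0.ne'
  have h2 : R u / (p : ℂ) - R x / (q : ℂ) = (R u - R x) * ((q⁻¹ : ℝ) : ℂ)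
      - R u * ((q⁻¹ - p⁻¹ : ℝ) : ℂ) := by
    push_cast; field_simp; ring
  have hpq' : 0 ≤ q⁻¹ - p⁻¹ := sub_nonneg.2 (inv_anti₀ hq0 hqp)
  have hux2 : u - x ≤ 2 * q := by linarith
  have h3 : ‖R u - R x‖ ≤ 2 * A * (u - x) + 3 * C * q := by
    have e1 := expSumError_sub_norm_le hpos hfin hA hx hxu t
    have e2 := (abs_le.1 (hE u (hx.trans hxu))).2
    have e3 := (abs_le.1 (hE x hx)).1
    rw [← Real.sqrt_eq_rpow] at e2 e3
    rw [← hp] at e2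
    rw [← hq] at e3
    nlinarith
  have h4 : ‖R u‖ ≤ (K + A) * u := by
    have e1 := expSumError_norm_le hpos hfin hA (hx.trans hxu) t
    linarith [hK u (hx.trans hxu)]
  have hKA : 0 ≤ K + A := nonneg_of_mul_nonneg_left ((norm_nonneg _).trans h4) hu0
  have h5 : u * (q⁻¹ - p⁻¹) ≤ 2 := by
    have : u * (q⁻¹ - p⁻¹) = p * (p - q) / q := by rw [← hp2]; field_simp
    rw [this, div_le_iff₀ hq0]
    nlinarith
  rw [h1, h2]
  refine (norm_sub_le _ _).trans ?_
  rw [norm_mul, norm_mul, Complex.norm_real, Complex.norm_real,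
    Real.norm_of_nonneg (inv_pos.2 hq0).le, Real.norm_of_nonneg hpq']
  calc _ ≤ (2 * A * (2 * q) + 3 * C * q) * q⁻¹ + (K + A) * u * (q⁻¹ - p⁻¹) := by
        gcongr
        exact h3.trans (by gcongr)
    _ = 4 * A + 3 * C + (K + A) * (u * (q⁻¹ - p⁻¹)) := by field_simp; ring
    _ ≤ 4 * A + 3 * C + (K + A) * 2 := by gcongr
    _ = _ := by ring

/-- At w = 1/2 + 2πiξ the inner Mellin integral is Z minus its main term, divided by w. This is ≪
(1+|t|)^ε (1+|ξ|)^(ε-1), just short of integrable; the decay of g(δξ) supplies the rest. -/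
theorem exists_smoothed_expSumError_bound {n : ℕ → ℝ} (hpos : ∀ j, 0 < n j)
    (hmono : Monotone n) (hfin : ∀ x, {j | n j ≤ x}.Finite) {K : ℝ} (hK0 : 0 < K)
    (hK : ∀ x, n 0 ≤ x → countingFunction n x ≤ K * x) {A θ C : ℝ} (hA : 0 < A) (hθ : 0 ≤ θ)
    (hθ₁ : θ < 1 / 2) (hC : 0 < C)
    (hE : ∀ x, n 0 ≤ x → |countingFunction n x - A * (x - n 0)| ≤ C * x ^ θ)
    {Z : ℂ → ℂ} (hZ : IsZetaContinuation n A θ Z) {ε D : ℝ} (hε : 0 < ε) (hε₁ : ε ≤ 1 / 2)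
    (hD0 : 0 < D) (hD : ∀ τ : ℝ, ‖Z (1 / 2 + Complex.I * (τ : ℂ))‖ ≤ D * (1 + |τ|) ^ ε) :
    ∃ D', 0 ≤ D' ∧ ∀ t y δ : ℝ, 0 < δ → δ ≤ 1 →
      ‖∫ u in Set.Ioi (n 0), expSumError n A t u * (u : ℂ) ^ (-(1 / 2 : ℂ) - 1)
        * (unitBump ((Real.log u - y) / δ) : ℂ)‖ ≤ δ * (D' * (1 + |t|) ^ ε * δ ^ (-(2 * ε))) := by
  obtain ⟨g, hg, ⟨Cg, hCg0, hCg⟩, hgb⟩ := exists_fourier_eq_unitBump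
  set D₁ := D + 2 * A * n 0 ^ (1 / 2 : ℝ)
  have hD₁ : 0 ≤ 2 * A * n 0 ^ (1 / 2 : ℝ) := by have := hpos 0; positivity
  have hpi : (2 * Real.pi) ≤ 7 := by linarith [Real.pi_lt_d2]
  have hinner : ∀ t ξ : ℝ, ‖∫ u in Set.Ioi (n 0), expSumError n A t u
      * (u : ℂ) ^ (-(1 / 2 : ℂ) - 1) * (u : ℂ) ^ (-(2 * Real.pi * ξ : ℝ) * Complex.I)‖
      ≤ 4 * D₁ * 7 ^ ε * (1 + |t|) ^ ε * (1 + |ξ|) ^ (ε - 1) := by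
    intro t ξ
    set w : ℂ := 1 / 2 + (2 * Real.pi * ξ : ℝ) * Complex.I with hw
    have hwre : w.re = 1 / 2 := by simp [hw]
    have hwim : w.im = 2 * Real.pi * ξ := by simp [hw]
    have hwt : w + Complex.I * t = 1 / 2 + Complex.I * ((2 * Real.pi * ξ + t : ℝ) : ℂ) := by
      rw [hw]; push_cast; ring
    have hne : w + Complex.I * t ≠ 1 := fun h => by
      have := congrArg Complex.re h
      simp [hwre] at this
    have h1 : ∫ u in Set.Ioi (n 0), expSumError n A t u
      * (u : ℂ) ^ (-(1 / 2 : ℂ) - 1) * (u : ℂ) ^ (-(2 * Real.pi * ξ : ℝ) * Complex.I)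
      = ∫ u in Set.Ioi (n 0), expSumError n A t u * (u : ℂ) ^ (-w - 1) := by
      refine MeasureTheory.setIntegral_congr_fun measurableSet_Ioi fun u hu => ?_
      have hu0 : (u : ℂ) ≠ 0 := by exact_mod_cast ((hpos 0).trans hu).ne'
      rw [mul_assoc, ← Complex.cpow_add _ _ hu0]
      congr 2
      rw [hw]; push_cast; ring
    have h2 := hZ.apply_eq hpos hmono hfin hK0 hK hθ hC hE t (w := w) (by rw [hwre]; exact hθ₁) hne
    rw [hwt] at h2
    rw [h1]
    set I := ∫ u in Set.Ioi (n 0), expSumError n A t u * (u : ℂ) ^ (-w - 1)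
    have h3 : ‖w‖ * ‖I‖ ≤ D₁ * (1 + |2 * Real.pi * ξ + t|) ^ ε := by
      have e1 : 1 ≤ (1 + |2 * Real.pi * ξ + t|) ^ ε :=
        Real.one_le_rpow (by linarith [abs_nonneg (2 * Real.pi * ξ + t)]) hε.le
      have e2 := hD (2 * Real.pi * ξ + t)
      have e3 := norm_main_term_le (hpos 0) hA (2 * Real.pi * ξ + t)
      rw [← norm_mul, ← sub_eq_of_eq_add' h2]
      refine (norm_sub_le _ _).trans ?_
      nlinarith
    have h4 : 1 + |ξ| ≤ 4 * ‖w‖ := by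
      have e1 := Complex.abs_re_le_norm w
      have e2 := Complex.abs_im_le_norm w
      rw [hwre, abs_of_pos (by norm_num)] at e1
      rw [hwim, abs_mul, abs_of_pos Real.two_pi_pos] at e2
      nlinarith [abs_nonneg ξ, Real.pi_gt_three]
    have h5 : 1 + |2 * Real.pi * ξ + t| ≤ 7 * ((1 + |t|) * (1 + |ξ|)) := by
      have e1 := abs_add_le (2 * Real.pi * ξ) t
      rw [abs_mul, abs_of_pos Real.two_pi_pos] at e1
      nlinarith [abs_nonneg ξ, abs_nonneg t, mul_nonneg (abs_nonneg ξ) (abs_nonneg t)]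
    have h6 : (1 + |2 * Real.pi * ξ + t|) ^ ε ≤ 7 ^ ε * ((1 + |t|) ^ ε * (1 + |ξ|) ^ ε) := by
      rw [← Real.mul_rpow (by positivity) (by positivity),
        ← Real.mul_rpow (by positivity) (by positivity)]
      gcongr
    have hξ : 0 < 1 + |ξ| := by positivity
    rw [Real.rpow_sub_one hξ.ne', mul_div_assoc', le_div_iff₀ hξ]
    have hD₁' : 0 ≤ D₁ := by positivity
    calc ‖I‖ * (1 + |ξ|) ≤ ‖I‖ * (4 * ‖w‖) := by gcongr
      _ = 4 * (‖w‖ * ‖I‖) := by ring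
      _ ≤ 4 * (D₁ * (7 ^ ε * ((1 + |t|) ^ ε * (1 + |ξ|) ^ ε))) := by
          exact mul_le_mul_of_nonneg_left
            (h3.trans (mul_le_mul_of_nonneg_left h6 hD₁')) (by norm_num)
      _ = _ := by ring
  have hD₁' : 0 ≤ D₁ := by positivity
  set J := ∫ ξ : ℝ, (1 + ‖ξ‖) ^ (-(1 + ε)) with hJ
  have hJ0 : 0 ≤ J := MeasureTheory.integral_nonneg fun ξ => by positivity
  refine ⟨Cg * (4 * D₁ * 7 ^ ε) * J, by positivity, fun t y δ hδ hδ₁ => ?_⟩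
  obtain ⟨C', hC', hE'⟩ := bound_rpow_mono (hpos 0) hC
    (show θ ≤ (θ + 1 / 2) / 2 by linarith) hE
  have hf : MeasureTheory.IntegrableOn
      (fun u : ℝ => expSumError n A t u * (u : ℂ) ^ (-(1 / 2 : ℂ) - 1)) (Set.Ioi (n 0)) :=
    integrableOn_mul_cpow (measurable_expSumError hmono hfin A t) (hpos 0)
      (fun u hu => expSumError_bound hpos hmono hfin hu t (by linarith) hE')
      (by simp; linarith)
  have hdual := integral_mul_fourier_log (hpos 0) hf hg hδ y
  simp_rw [hgb] at hdual
  rw [hdual, norm_mul, Complex.norm_real, Real.norm_of_nonneg hδ.le]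
  gcongr
  -- Only the power 2ε ≤ 1 of the available decay is spent: it makes the ξ-integrand
  -- O((1+|ξ|)^(-1-ε)) and costs no more than δ^(-2ε).
  have hgδ : ∀ ξ, ‖g (δ * ξ)‖ ≤ Cg * (δ ^ (-(2 * ε)) * (1 + |ξ|) ^ (-(2 * ε))) := fun ξ => by
    have hξ : 0 < 1 + |ξ| := by positivity
    have hη : 0 < 1 + |δ * ξ| := by positivity
    have e1 : δ * (1 + |ξ|) ≤ 1 + |δ * ξ| := by
      rw [abs_mul, abs_of_pos hδ]; nlinarith
    have e2 : (1 + |δ * ξ|) ^ (-1 : ℝ) ≤ (1 + |δ * ξ|) ^ (-(2 * ε)) :=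
      Real.rpow_le_rpow_of_exponent_le (by linarith [abs_nonneg (δ * ξ)]) (by linarith)
    have e3 : (1 + |δ * ξ|) ^ (-(2 * ε)) ≤ (δ * (1 + |ξ|)) ^ (-(2 * ε)) :=
      Real.rpow_le_rpow_of_nonpos (by positivity) e1 (by linarith)
    rw [Real.mul_rpow hδ.le hξ.le] at e3
    calc ‖g (δ * ξ)‖ ≤ Cg / (1 + |δ * ξ|) := (le_div_iff₀ hη).2 (hCg _)
      _ = Cg * (1 + |δ * ξ|) ^ (-1 : ℝ) := by rw [Real.rpow_neg_one, div_eq_mul_inv]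
      _ ≤ _ := by gcongr; exact e2.trans e3
  refine (MeasureTheory.norm_integral_le_of_norm_le
    (g := fun ξ : ℝ => Cg * (4 * D₁ * 7 ^ ε) * (1 + |t|) ^ ε * δ ^ (-(2 * ε))
      * (1 + ‖ξ‖) ^ (-(1 + ε)))
    ((integrable_one_add_norm (by simp [hε])).const_mul _)
    (MeasureTheory.ae_of_all _ fun ξ => ?_)).trans (le_of_eq ?_)
  · rw [norm_mul, norm_mul, Complex.norm_exp_ofReal_mul_I, one_mul, Real.norm_eq_abs]
    have hξ : 0 < 1 + |ξ| := by positivity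
    calc _ ≤ Cg * (δ ^ (-(2 * ε)) * (1 + |ξ|) ^ (-(2 * ε)))
          * (4 * D₁ * 7 ^ ε * (1 + |t|) ^ ε * (1 + |ξ|) ^ (ε - 1)) :=
          mul_le_mul (hgδ ξ) (hinner t ξ) (norm_nonneg _) (by positivity)
      _ = _ := by
          have : (1 + |ξ|) ^ (-(1 + ε)) = (1 + |ξ|) ^ (-(2 * ε)) * (1 + |ξ|) ^ (ε - 1) := by
            rw [← Real.rpow_add hξ]; congr 1; ring
          rw [this]; ring
  · rw [MeasureTheory.integral_const_mul, ← hJ]; ring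

theorem lindelofHypothesis_of_critical_line {n : ℕ → ℝ} (hpos : ∀ j, 0 < n j)
    (hmono : Monotone n) (hfin : ∀ x, {j | n j ≤ x}.Finite) {K : ℝ} (hK0 : 0 < K)
    (hK : ∀ x, n 0 ≤ x → countingFunction n x ≤ K * x) {A θ C : ℝ} (hA : 0 < A) (hθ : 0 ≤ θ)
    (hθ₁ : θ < 1 / 2) (hC : 0 < C)
    (hE : ∀ x, n 0 ≤ x → |countingFunction n x - A * (x - n 0)| ≤ C * x ^ θ)
    {Z : ℂ → ℂ} (hZ : IsZetaContinuation n A θ Z)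
    (h : ∀ ε : ℝ, 0 < ε →
      (fun τ : ℝ => Z (1 / 2 + Complex.I * (τ : ℂ))) =O[cocompact ℝ] fun τ : ℝ => |τ| ^ ε) :
    LindelofHypothesis n (fun x => A * x) := by
  rw [lindelofHypothesis_iff]
  intro ε₀ B hε₀ hB
  -- The final loss is |t|^ε from Z and δ^(-2ε) ≪ x^ε ≤ |t|^(Bε) from the smoothing, so ε(1 + B) ≤
  -- ε₀ is required.
  set ε := min (ε₀ / (1 + B)) (1 / 2) with hε_def
  have hε : 0 < ε := by positivity
  have hεB : ε + B * ε ≤ ε₀ := by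
    have := mul_le_mul_of_nonneg_right (min_le_left (ε₀ / (1 + B)) (1 / 2))
      (by linarith : 0 ≤ 1 + B)
    rw [div_mul_cancel₀ _ (by linarith : (1 + B) ≠ 0), ← hε_def] at this
    linarith
  obtain ⟨D, hD0, hD⟩ := exists_bound_of_isBigO_cocompact (hZ.continuous_critical_line hθ₁) hε.le
    (h ε hε)
  obtain ⟨D', hD'0, hD'⟩ := exists_smoothed_expSumError_bound hpos hmono hfin hK0 hK hA hθ hθ₁ hC
    hE hZ hε (min_le_right _ _) hD0 hD
  obtain ⟨C', hC', hE'⟩ := bound_rpow_mono (hpos 0) hC hθ₁.le hE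
  have ha := hpos 0
  set c := min 1 (√(n 0)) with hc_def
  have hc : 0 < c := lt_min one_pos (Real.sqrt_pos.2 ha)
  have hc1 : c ≤ 1 := min_le_left _ _
  set M := 6 * A + 3 * C' + 2 * K with hM_def
  have hM0 : 0 < M := by positivity
  -- From n 0 ≤ x ≤ |t|^B one gets |t| ≥ m. Since m may be below 1, the factor 1 + 1/m is carried
  -- along so that (1 + 1/m)|t| ≥ 1 + |t|.
  set m := n 0 ^ (1 / B) with hm_def
  have hm : 0 < m := Real.rpow_pos_of_pos ha _
  have hlast : ∀ x t : ℝ, n 0 ≤ x → x ≤ |t| ^ B → ‖expSumError n A t x‖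
      ≤ (M + 2 * (D' * (1 + 1 / m) ^ ε * c ^ (-(2 * ε)))) * (1 + 1 / m) ^ ε₀
        * (x ^ (1 / 2 : ℝ) * |t| ^ ε₀) := by
    intro x t hx hxt
    have hx0 := ha.trans_le hx
    have hq0 : 0 < √x := Real.sqrt_pos.2 hx0
    have ht0 : 0 < |t| := by
      refine lt_of_le_of_ne (abs_nonneg t) fun h0 => ?_
      rw [← h0, Real.zero_rpow hB.ne'] at hxt
      linarith
    have hmt : m ≤ |t| := by
      calc m ≤ (|t| ^ B) ^ (1 / B) := by
            rw [hm_def]; exact Real.rpow_le_rpow ha.le (hx.trans hxt) (by positivity)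
        _ = |t| := by rw [← Real.rpow_mul ht0.le, mul_one_div_cancel hB.ne', Real.rpow_one]
    have hb : 1 + |t| ≤ (1 + 1 / m) * |t| := by
      have : 1 ≤ |t| / m := (one_le_div hm).2 hmt
      rw [add_mul, one_mul, one_div_mul_eq_div]; linarith
    have hcq : c ≤ √x := (min_le_right _ _).trans (Real.sqrt_le_sqrt hx)
    -- The window [x, x e^δ] then has length at most 2xδ = 2c√x, the scale on which R_t moves by
    -- O(√x); c ≤ √(n 0) ensures δ ≤ 1.
    set δ := c / √x with hδ_def
    have hδ : 0 < δ := by positivity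
    have hδ1 : δ ≤ 1 := (div_le_one hq0).2 hcq
    have hexp : Real.exp δ ≤ 1 + 2 * δ := by
      have := Real.abs_exp_sub_one_le (x := δ) (by rwa [abs_of_pos hδ])
      rw [abs_of_pos hδ] at this
      linarith [le_abs_self (Real.exp δ - 1)]
    have hxx : √x * √x = x := Real.mul_self_sqrt hx0.le
    have hxδ : x * δ = c * √x := by
      rw [hδ_def, mul_div_assoc', div_eq_iff hq0.ne']
      linear_combination (-c) * hxx
    have hM : ∀ u, x ≤ u → u ≤ x * Real.exp δ →
        ‖u * (expSumError n A t u * (u : ℂ) ^ (-(1 / 2 : ℂ) - 1))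
          - expSumError n A t x / (√x : ℂ)‖ ≤ M := by
      intro u hxu hux
      have h1 : u ≤ x * (1 + 2 * δ) := hux.trans (by gcongr)
      refine norm_expSumError_mul_cpow_sub_le hpos hfin hK hA hC' hE' t hx hxu ?_ ?_
      · nlinarith
      · nlinarith
    have hf : MeasureTheory.IntegrableOn
        (fun u : ℝ => expSumError n A t u * (u : ℂ) ^ (-(1 / 2 : ℂ) - 1)) (Set.Ioi (n 0)) := by
      obtain ⟨C'', hC'', hE''⟩ := bound_rpow_mono ha hC
        (show θ ≤ (θ + 1 / 2) / 2 by linarith) hE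
      exact integrableOn_mul_cpow (measurable_expSumError hmono hfin A t) ha
        (fun u hu => expSumError_bound hpos hmono hfin hu t (by linarith) hE'')
        (by simp; linarith)
    have h1 := norm_le_of_smoothed ha hx hδ hf (expSumError n A t x / (√x : ℂ)) hM
    have h2 := hD' t (Real.log x) δ hδ hδ1
    have h3 : δ ^ (-(2 * ε)) ≤ c ^ (-(2 * ε)) * |t| ^ (B * ε) := by
      rw [hδ_def, Real.div_rpow hc.le hq0.le, div_eq_mul_inv, Real.rpow_neg hq0.le, inv_inv,
        Real.rpow_mul hq0.le, Real.rpow_two, Real.sq_sqrt hx0.le, Real.rpow_mul ht0.le]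
      gcongr
    have h4 : (1 + |t|) ^ ε ≤ (1 + 1 / m) ^ ε * |t| ^ ε := by
      rw [← Real.mul_rpow (by positivity) ht0.le]; gcongr
    have hone : 1 ≤ (1 + 1 / m) * |t| := by linarith
    have h5 : 1 ≤ (1 + 1 / m) ^ ε₀ * |t| ^ ε₀ := by
      rw [← Real.mul_rpow (by positivity) ht0.le]; exact Real.one_le_rpow hone hε₀.le
    have h6 : |t| ^ (ε + B * ε) ≤ (1 + 1 / m) ^ ε₀ * |t| ^ ε₀ := by
      calc |t| ^ (ε + B * ε) ≤ ((1 + 1 / m) * |t|) ^ (ε + B * ε) := by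
            gcongr
            exact le_mul_of_one_le_left ht0.le (by linarith [one_div_pos.2 hm])
        _ ≤ ((1 + 1 / m) * |t|) ^ ε₀ := Real.rpow_le_rpow_of_exponent_le hone hεB
        _ = _ := Real.mul_rpow (by positivity) ht0.le
    rw [norm_div, Complex.norm_real, Real.norm_of_nonneg hq0.le, div_le_iff₀ hq0] at h1
    rw [← Real.sqrt_eq_rpow]
    set P := (1 + 1 / m) ^ ε₀ * |t| ^ ε₀
    set E := D' * (1 + 1 / m) ^ ε * c ^ (-(2 * ε))
    have hE0 : 0 ≤ E := by positivity
    have h7 : D' * (1 + |t|) ^ ε * δ ^ (-(2 * ε)) ≤ E * P := by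
      calc _ ≤ D' * ((1 + 1 / m) ^ ε * |t| ^ ε) * (c ^ (-(2 * ε)) * |t| ^ (B * ε)) := by
            gcongr
        _ = E * |t| ^ (ε + B * ε) := by rw [Real.rpow_add ht0]; ring
        _ ≤ _ := by gcongr
    calc ‖expSumError n A t x‖
        ≤ (M + 2 / δ * (δ * (D' * (1 + |t|) ^ ε * δ ^ (-(2 * ε))))) * √x :=
          h1.trans (by gcongr)
      _ = (M + 2 * (D' * (1 + |t|) ^ ε * δ ^ (-(2 * ε)))) * √x := by field_simp
      _ ≤ (M * P + 2 * (E * P)) * √x := by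
          gcongr
          exact le_mul_of_one_le_right hM0.le h5
      _ = _ := by simp only [P]; ring
  refine ⟨(M + 2 * (D' * (1 + 1 / m) ^ ε * c ^ (-(2 * ε)))) * (1 + 1 / m) ^ ε₀
    / A ^ (1 / 2 : ℝ), fun x t hx hxt => (hlast x t hx hxt).trans (le_of_eq ?_)⟩
  have hA' : 0 < A ^ (1 / 2 : ℝ) := by positivity
  rw [Real.mul_rpow hA.le (ha.trans_le hx).le]
  field_simp

theorem mainTheorem9 (n : ℕ → ℝ) (hpos : ∀ j, 0 < n j) (hmono : Monotone n)
    (A θ : ℝ) (hA : 0 < A) (hθ₀ : 0 ≤ θ) (hθ₁ : θ < 1 / 2)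
    (hN : (fun x : ℝ => countingFunction n x - A * x) =O[atTop] fun x : ℝ => x ^ θ) :
    (∃ Z : ℂ → ℂ, IsZetaContinuation n A θ Z) ∧
    ∀ Z : ℂ → ℂ, IsZetaContinuation n A θ Z →
      (LindelofHypothesis n (fun x => A * x) ↔
        ∀ ε : ℝ, 0 < ε →
          (fun τ : ℝ => Z (1 / 2 + Complex.I * (τ : ℂ))) =O[cocompact ℝ] fun τ : ℝ => |τ| ^ ε) := by
  have hfin := finite_setOf_le_of_counting hmono hA (by linarith) hN
  obtain ⟨C, hC, hE⟩ := counting_eventual_bound (hpos 0) hfin hA hθ₀ hN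
  obtain ⟨K, hK0, hK⟩ := counting_linear_bound (hpos 0) hA hC (by linarith) hE
  obtain ⟨C', hC', hE'⟩ := counting_shifted_bound (hpos 0) hA hC hθ₀ hE
  refine ⟨exists_isZetaContinuation hpos hmono hfin hK0 hK hE', fun Z hZ => ⟨fun h ε hε =>
    critical_line_of_lindelofHypothesis hpos hmono hfin hK0 hK hA hθ₀ hθ₁ hC' hE' hZ h hε,
    fun h => lindelofHypothesis_of_critical_line hpos hmono hfin hK0 hK hA hθ₀ hθ₁ hC' hE' hZ h⟩⟩
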